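/- **Setting.** A ribbon graph $G$ has $n\ge 1$ vertices, each with a finite positive number of corners (half-lines) numbered $1,2,\dots$ in cyclic order, and $L$ internal lines; a line $\ell$ joins two distinct corners (it exits at one and enters at the other), each corner carries at most one line, and the $N$ corners carrying no line are external. With $\sigma$ the permutation "next corner around the vertex" and $\alpha$ the involution exchanging the ends of each line and fixing the external corners, the faces are the cycles of $\sigma\alpha$; $F$ is their number. The dual graph has the faces as vertices, and each line joins the faces on its two sides. The genus $g$ of a connected graph is given by $2-2g=n-L+F$. $G$ is *orientable* if its corners can be given signs alternating around each vertex so that each line joins corners of opposite sign. Fix a root vertex $\bar v$. Let $\varepsilon_{\ell i}=1$ if $\ell$ enters at the corner $i$, $-1$ if it exits at $i$, $0$ otherwise; $\eta_{\ell i}=|\varepsilon_{\ell i}|$; $\omega(i,j)=1$ if $i<j$ and $-1$ if $i>j$. For functions $f,h$ on corners put $\langle f,h\rangle=\sum_v\sum_{i\ne j\in v}(-1)^{i+j+1}\omega(i,j)f_ih_j$. Let $E$ be the $2L\times 2L$ matrix with blocks $E^{uu}_{\ell\ell'}=\langle\varepsilon_\ell,\varepsilon_{\ell'}\rangle$, $E^{uv}_{\ell\ell'}=\langle\varepsilon_\ell,\eta_{\ell'}\rangle$,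 $E^{vv}_{\ell\ell'}=\langle\eta_\ell,\eta_{\ell'}\rangle$, $E^{vu}=-(E^{uv})^t$, and $C$ the $2L\times(n-1)$ matrix with entries $\sum_{i\in v}(-1)^{i+1}\varepsilon_{\ell i}$ (rows $u_\ell$) and $\sum_{i\in v}(-1)^{i+1}\eta_{\ell i}$ (rows $v_\ell$), for $v\ne\bar v$. Put $$B'=\begin{pmatrix}E&C\\-C^t&0\end{pmatrix},\quad B=\begin{pmatrix}sE&C\\-C^t&0\end{pmatrix},\quad A=\mathrm{diag}(1/t_\ell;\,t_\ell;\,0),\quad HU_{G,\bar v}(t)=\Big(\prod_\ell t_\ell\Big)\det(A+B),$$ with a parameter $s>0$. For sets of lines $I,J$ let $n_{I,J}$ be the Pfaffian of $B'$ with the rows and columns of the short variables $u_\ell$, $\ell\in I$, and of the long variables $v_\ell$, $\ell\in J$, deleted (in any ordering of the remaining indices; the ordering only affects the sign), $k_{I,J}=|I|+|J|-L-F+1$ and $k_J=|J|-F+1$. A set $J$ of lines is *admissible* if it contains a spanning tree of the dual graph, and its complement contains a spanning tree $T$ of $G$ such that removing the lines of $J$ and contracting the lines of $T$ (gluing their end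 vertices compatibly with the cyclic orders) gives a graph with one vertex and one face. **Statement.** Let $G$ be orientable. 1. (The graph need not be connected; a rosette is the case $n=1$.) The determinants of $$\begin{pmatrix}\langle\eta_\ell,\eta_{\ell'}\rangle&\sum_{i\in v}(-1)^{i+1}\eta_{\ell i}\\ -\sum_{i\in v}(-1)^{i+1}\eta_{\ell i}&0\end{pmatrix}\quad\text{and}\quad\begin{pmatrix}\sum_v\sum_{i\ne j\in v}\omega(i,j)\varepsilon_{\ell i}\varepsilon_{\ell' j}&\sum_{i\in v}\varepsilon_{\ell i}\\-\sum_{i\in v}\varepsilon_{\ell i}&0\end{pmatrix}$$ (size $L+n-1$, with $v\neq\bar v$) are both $0$ if $F>1$ and both $2^{2g}$ if $F=1$. Suppose moreover that $G$ is connected. Then $g$ is a well-defined natural number, $2-2g=n-L+F$, and: 2. For $I$ the set of all lines, $n_{I,J}\ne0$ if and only if $J$ is admissible, and then $n_{I,J}^2=2^{2g-k_J}$. If $J$ is admissible, $k_J$ is even and $0\le k_J\le 2g$; moreover $J$ is admissible with $k_J=0$ if and only if $J$ is a spanning tree of the dual graph. 3. For all nonzero $t_\ell$: $\displaystyle HU_{G,\bar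 v}(t)=\sum_{I,J}s^{2g-k_{I,J}}\,n_{I,J}^2\prod_{\ell\notin I}t_\ell\prod_{\ell\in J}t_\ell$. For all $t_\ell>0$: $$HU_{G,\bar v}(t)\ \ge\sum_{J\text{ admissible}}(2s)^{2g-k_J}\prod_{\ell\in J}t_\ell,\qquad HU_{G,\bar v}(t)\ \ge\ (2s)^{2g}\sum_{J\text{ tree of the dual graph}}\ \prod_{\ell\in J}t_\ell .$$ 4. (Exact power counting.) For all fixed $x_\ell>0$, as $\lambda\to0^+$, $HU_{G,\bar v}(\lambda x)$ is of exact order $\lambda^{F-1}$ (bounded above and below by positive multiples of it). If all vertices have four corners, then in dimension $D=4$ the radial density of the amplitude at vanishing external arguments, $\lambda^{2L-1}\prod_\ell(1-t_\ell^2)\,HU_{G,\bar v}(t)^{-2}$ at $t_\ell=\lambda^2x_\ell$, is of exact order $\lambda^{8g+N-4}\cdot\lambda^{-1}$. -/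

import Mathlib

open scoped Topology

noncomputable section

namespace NCQFT

/-! ### Ribbon graphs -/

/-- A ribbon graph with set of corners (half-lines) `D` and set of internal lines `Λ`.  The
permutation `next` sends a corner to its successor in the cyclic order around its vertex, so that
the vertices are the cycles of `next`.  The line `l` joins the two distinct corners `tail l` and
`head l`, and no corner is used twice.  The corners touched by no line are external half-lines. -/
structure RibbonGraph (D Λ : Type*) where
  next : Equiv.Perm D
  tail : Λ → D
  head : Λ → D
  inj : Function.Injective (Sum.elim tail head)

/-- The orbit of an element satisfying `p` under a permutation of a finite set comes back to `p`. -/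
theorem exists_return {D : Type*} [Finite D] (π : Equiv.Perm D) (p : D → Prop) (x : {d // p d}) :
    ∃ k, 0 < k ∧ p ((π ^ k) x.1) :=
  ⟨orderOf π, orderOf_pos π, by rw [pow_orderOf_eq_one]; exact x.2⟩

open Classical in
/-- The first positive time at which the orbit of `x` under `π` satisfies `p`. -/
def returnTime {D : Type*} [Finite D] (π : Equiv.Perm D) (p : D → Prop) (x : {d // p d}) : ℕ :=
  Nat.find (exists_return π p x)

theorem returnTime_spec {D : Type*} [Finite D] (π : Equiv.Perm D) (p : D → Prop)
    (x : {d // p d}) : 0 < returnTime π p x ∧ p ((π ^ returnTime π p x) x.1) := by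
  classical
  exact Nat.find_spec (exists_return π p x)

theorem returnTime_le {D : Type*} [Finite D] (π : Equiv.Perm D) (p : D → Prop)
    (x : {d // p d}) {k : ℕ} (hk : 0 < k) (h : p ((π ^ k) x.1)) : returnTime π p x ≤ k := by
  classical
  exact Nat.find_min' (exists_return π p x) ⟨hk, h⟩

/-- The first element satisfying `p` in the sequence `π x, π (π x), …`. -/
def firstReturn {D : Type*} [Finite D] (π : Equiv.Perm D) (p : D → Prop) (x : {d // p d}) :
    {d // p d} :=
  ⟨(π ^ returnTime π p x) x.1, (returnTime_spec π p x).2⟩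

theorem firstReturn_injective {D : Type*} [Finite D] (π : Equiv.Perm D) (p : D → Prop) :
    Function.Injective (firstReturn π p) := by
  have key : ∀ x y : {d // p d}, returnTime π p x ≤ returnTime π p y →
      firstReturn π p x = firstReturn π p y → x = y := by
    intro x y hle h
    have h1 : (π ^ returnTime π p x) x.1 = (π ^ returnTime π p y) y.1 := congrArg Subtype.val h
    obtain ⟨d, hd⟩ := Nat.exists_eq_add_of_le hle
    rw [hd, pow_add, Equiv.Perm.mul_apply] at h1
    have h2 : x.1 = (π ^ d) y.1 := (π ^ returnTime π p x).injective h1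
    rcases Nat.eq_zero_or_pos d with h0 | hpos
    · subst h0
      exact Subtype.ext (by simpa using h2)
    · have h3 := returnTime_le π p y hpos (by rw [← h2]; exact x.2)
      have h4 := (returnTime_spec π p x).1
      omega
  intro x y h
  rcases le_total (returnTime π p x) (returnTime π p y) with hle | hle
  · exact key x y hle h
  · exact (key y x hle h.symm).symm

/-- The return permutation of `π` on the elements satisfying `p`: `x` is sent to the first element
satisfying `p` in the sequence `π x, π (π x), …`. -/
def returnPerm {D : Type*} [Finite D] (π : Equiv.Perm D) (p : D → Prop) :
    Equiv.Perm {d // p d} :=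
  Equiv.ofBijective (firstReturn π p)
    (Finite.injective_iff_bijective.1 (firstReturn_injective π p))

/-- `T` is (the set of lines of) a spanning tree of the multigraph with vertex set `V` whose line
`l` joins `a l` to `b l`: it connects all the vertices and has one line less than there are
vertices. -/
def IsSpanningTree {V Λ : Type*} (a b : Λ → V) (T : Finset Λ) : Prop :=
  (∀ x y : V, Relation.EqvGen (fun x y => ∃ l ∈ T, a l = x ∧ b l = y) x y) ∧
    T.card + 1 = Nat.card V

namespace RibbonGraph

variable {D Λ : Type*} (R : RibbonGraph D Λ)

open Classical in
/-- The other end of the line touching the corner `c` (and `c` itself if `c` is external). -/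
def oppFun (c : D) : D :=
  if h : ∃ l, R.tail l = c then R.head h.choose
  else if h : ∃ l, R.head l = c then R.tail h.choose
  else c

theorem oppFun_tail (l : Λ) : R.oppFun (R.tail l) = R.head l := by
  have h : ∃ l', R.tail l' = R.tail l := ⟨l, rfl⟩
  have h2 : h.choose = l := by
    have := R.inj (a₁ := Sum.inl h.choose) (a₂ := Sum.inl l) h.choose_spec
    exact Sum.inl.inj this
  rw [oppFun, dif_pos h, h2]

theorem oppFun_head (l : Λ) : R.oppFun (R.head l) = R.tail l := by
  have h0 : ¬ ∃ l', R.tail l' = R.head l := by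
    rintro ⟨l', h⟩
    have := R.inj (a₁ := Sum.inl l') (a₂ := Sum.inr l) h
    cases this
  have h : ∃ l', R.head l' = R.head l := ⟨l, rfl⟩
  have h2 : h.choose = l := by
    have := R.inj (a₁ := Sum.inr h.choose) (a₂ := Sum.inr l) h.choose_spec
    exact Sum.inr.inj this
  rw [oppFun, dif_neg h0, dif_pos h, h2]

theorem oppFun_involutive : Function.Involutive R.oppFun := by
  intro c
  by_cases h : ∃ l, R.tail l = c
  · obtain ⟨l, rfl⟩ := h
    rw [oppFun_tail, oppFun_head]
  · by_cases h' : ∃ l, R.head l = c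
    · obtain ⟨l, rfl⟩ := h'
      rw [oppFun_head, oppFun_tail]
    · have : R.oppFun c = c := by rw [oppFun, dif_neg h, dif_neg h']
      rw [this, this]

/-- The involution exchanging the two ends of every line and fixing the external corners. -/
def opp : Equiv.Perm D := R.oppFun_involutive.toPerm

/-- One step along the boundary of a face: cross the line, then turn to the next corner. -/
def faceNext : Equiv.Perm D := R.next * R.opp

/-- The vertices: cycles of `next`. -/
def Vertex : Type _ := Quotient (Equiv.Perm.SameCycle.setoid R.next)

/-- The faces: cycles of `faceNext`. -/
def Face : Type _ := Quotient (Equiv.Perm.SameCycle.setoid R.faceNext)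

/-- The face on the side of its line (or of its external half-line) that leaves the corner `c`. -/
def faceOf (c : D) : R.Face := Quotient.mk (Equiv.Perm.SameCycle.setoid R.faceNext) c

/-- `T` is a tree in the dual graph, whose vertices are the faces and in which the line `l` joins
the faces on its two sides. -/
def IsDualTree (T : Finset Λ) : Prop :=
  IsSpanningTree (fun l => R.faceOf (R.tail l)) (fun l => R.faceOf (R.head l)) T

/-- Keep only the lines satisfying `p`; the ends of the other lines become external corners. -/
def keepLines (p : Λ → Prop) : RibbonGraph D {l // p l} where
  next := R.next
  tail l := R.tail l.1
  head l := R.head l.1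
  inj := by
    intro x y h
    rcases x with x | x <;> rcases y with y | y
    · exact congrArg Sum.inl (Subtype.ext
        (Sum.inl.inj (R.inj (a₁ := Sum.inl x.1) (a₂ := Sum.inl y.1) h)))
    · have := R.inj (a₁ := Sum.inl x.1) (a₂ := Sum.inr y.1) h
      cases this
    · have := R.inj (a₁ := Sum.inr x.1) (a₂ := Sum.inl y.1) h
      cases this
    · exact congrArg Sum.inr (Subtype.ext
        (Sum.inr.inj (R.inj (a₁ := Sum.inr x.1) (a₂ := Sum.inr y.1) h)))

/-- Remove the lines of `J`. -/
def deleteLines (J : Finset Λ) : RibbonGraph D {l // l ∉ J} := R.keepLines (fun l => l ∉ J)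

/-- The corner `c` is not an end of a line of `T`. -/
def Avoids (T : Finset Λ) (c : D) : Prop := ∀ l ∈ T, R.tail l ≠ c ∧ R.head l ≠ c

theorem avoids_tail {T : Finset Λ} {l : Λ} (hl : l ∉ T) : R.Avoids T (R.tail l) := by
  intro l' hl'
  constructor
  · intro h
    have := R.inj (a₁ := Sum.inl l') (a₂ := Sum.inl l) h
    exact hl (Sum.inl.inj this ▸ hl')
  · intro h
    have := R.inj (a₁ := Sum.inr l') (a₂ := Sum.inl l) h
    cases this

theorem avoids_head {T : Finset Λ} {l : Λ} (hl : l ∉ T) : R.Avoids T (R.head l) := by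
  intro l' hl'
  constructor
  · intro h
    have := R.inj (a₁ := Sum.inl l') (a₂ := Sum.inr l) h
    cases this
  · intro h
    have := R.inj (a₁ := Sum.inr l') (a₂ := Sum.inr l) h
    exact hl (Sum.inr.inj this ▸ hl')

/-- Contract the lines of `T` (first Filk moves): the two ends of every line of `T` disappear, and
the vertices at the two ends of the line are glued respecting the cyclic orders.  After a corner
`c` comes the corner `next c`; if that is an end of a line of `T`, the line is crossed and one goes
on to the next corner, and so on. -/
def contractLines [Finite D] (T : Finset Λ) :
    RibbonGraph {c // R.Avoids T c} {l // l ∉ T} where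
  next := returnPerm (R.next * (R.keepLines (fun l => l ∈ T)).opp) (R.Avoids T)
  tail l := ⟨R.tail l.1, R.avoids_tail l.2⟩
  head l := ⟨R.head l.1, R.avoids_head l.2⟩
  inj := by
    intro x y h
    rcases x with x | x <;> rcases y with y | y
    · exact congrArg Sum.inl (Subtype.ext
        (Sum.inl.inj (R.inj (a₁ := Sum.inl x.1) (a₂ := Sum.inl y.1) (congrArg Subtype.val h))))
    · have := R.inj (a₁ := Sum.inl x.1) (a₂ := Sum.inr y.1) (congrArg Subtype.val h)
      cases this
    · have := R.inj (a₁ := Sum.inr x.1) (a₂ := Sum.inl y.1) (congrArg Subtype.val h)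
      cases this
    · exact congrArg Sum.inr (Subtype.ext
        (Sum.inr.inj (R.inj (a₁ := Sum.inr x.1) (a₂ := Sum.inr y.1) (congrArg Subtype.val h))))

/-- A superrosette: one vertex and one face. -/
def IsSuperrosette : Prop := Nat.card R.Vertex = 1 ∧ Nat.card R.Face = 1

end RibbonGraph

/-! ### Ribbon graphs with numbered corners -/

/-- A ribbon graph with vertex set `V`, whose vertex `v` has `deg v` corners numbered in cyclic
order (`0, 1, …, deg v - 1`; the customary numbers are `1, …, deg v`), and whose internal line `l`
exits at the corner `tail l` and enters at the corner `head l`.  The orientations of the lines and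
the starting points of the numberings are arbitrary.  In `φ⋆⁴` theory all degrees are `4`; a
rosette is the case of a single vertex. -/
structure FeynmanGraph (V Λ : Type*) where
  deg : V → ℕ
  deg_pos : ∀ v, 0 < deg v
  tail : Λ → Σ v, Fin (deg v)
  head : Λ → Σ v, Fin (deg v)
  inj : Function.Injective (Sum.elim tail head)

namespace FeynmanGraph

variable {V Λ : Type*} (G : FeynmanGraph V Λ)

/-- The corners of the graph. -/
abbrev Corner : Type _ := Σ v, Fin (G.deg v)

/-- The successor of a corner in the cyclic order of its vertex. -/
def next : Equiv.Perm G.Corner := Equiv.sigmaCongrRight (fun v => finRotate (G.deg v))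

/-- The underlying ribbon graph. -/
def ribbon : RibbonGraph G.Corner Λ where
  next := G.next
  tail := G.tail
  head := G.head
  inj := G.inj

/-- Orientability: the corners can be given signs which alternate around every vertex, in such a
way that every line joins two corners of opposite signs. -/
def Orientable : Prop :=
  ∃ χ : G.Corner → ℤˣ, (∀ c, χ (G.next c) = -χ c) ∧ ∀ l, χ (G.head l) = -χ (G.tail l)

/-- Connectedness. -/
def Connected : Prop :=
  ∀ v w : V, Relation.EqvGen (fun v w => ∃ l, (G.tail l).1 = v ∧ (G.head l).1 = w) v w

/-- `T` is a spanning tree of the (direct) graph. -/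
def IsTree (T : Finset Λ) : Prop :=
  IsSpanningTree (fun l => (G.tail l).1) (fun l => (G.head l).1) T

/-- The number of faces. -/
def numFaces : ℕ := Nat.card G.ribbon.Face

/-- The number of external corners. -/
def numExternal : ℕ := Nat.card {c : G.Corner // ∀ l, G.tail l ≠ c ∧ G.head l ≠ c}

/-- The set `J` of lines is admissible: it contains a tree of the dual graph, its complement
contains a tree `T` of the direct graph, and removing `J` and contracting `T` gives a
superrosette. -/
def Admissible [Finite V] (J : Finset Λ) : Prop :=
  (∃ S, S ⊆ J ∧ G.ribbon.IsDualTree S) ∧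
  ∃ T : Finset {l // l ∉ J}, G.IsTree (T.map (Function.Embedding.subtype _)) ∧
    ((G.ribbon.deleteLines J).contractLines T).IsSuperrosette

variable [Fintype V] [DecidableEq V] [Fintype Λ] [DecidableEq Λ]

/-- The genus `g`, given by `2 - 2 g = n - L + F` (for a connected graph). -/
def genus : ℕ :=
  ((2 - ((Fintype.card V : ℤ) - Fintype.card Λ + G.numFaces)) / 2).toNat

/-! ### The oscillation matrices -/

/-- The incidence matrix between lines and corners: `1` where the line enters, `-1` where it
exits. -/
def eps (l : Λ) (c : G.Corner) : ℤ :=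
  if G.head l = c then 1 else if G.tail l = c then -1 else 0

/-- The absolute value of the incidence matrix. -/
def eta (l : Λ) (c : G.Corner) : ℤ := |G.eps l c|

/-- `ω(i,j)` is `1` if `i < j`, `-1` if `i > j` (and `0` if `i = j`). -/
def omega {d : ℕ} (i j : Fin d) : ℤ := if i < j then 1 else if j < i then -1 else 0

/-- `∑_v ∑_{i ≠ j, i, j ∈ v} (-1)^{i+j+1} ω(i,j) f_i g_j`. -/
def oscillation (f g : G.Corner → ℤ) : ℤ :=
  ∑ v, ∑ i : Fin (G.deg v), ∑ j : Fin (G.deg v),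
    (-1) ^ ((i : ℕ) + j + 1) * omega i j * f ⟨v, i⟩ * g ⟨v, j⟩

/-- `∑_{i ∈ v} (-1)^{i+1} f_i` with corners numbered from `1`, i.e. `(-1)^i` numbered from `0`. -/
def alternating (v : V) (f : G.Corner → ℤ) : ℤ :=
  ∑ i : Fin (G.deg v), (-1) ^ (i : ℕ) * f ⟨v, i⟩

/-- The block `E^{uu}`. -/
def Euu : Matrix Λ Λ ℤ := Matrix.of fun l l' => G.oscillation (G.eps l) (G.eps l')

/-- The block `E^{uv}`. -/
def Euv : Matrix Λ Λ ℤ := Matrix.of fun l l' => G.oscillation (G.eps l) (G.eta l')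

/-- The block `E^{vv}`. -/
def Evv : Matrix Λ Λ ℤ := Matrix.of fun l l' => G.oscillation (G.eta l) (G.eta l')

/-- The matrix `E`, indexed by short variables (first summand) and long variables (second). -/
def E : Matrix (Λ ⊕ Λ) (Λ ⊕ Λ) ℤ :=
  Matrix.fromBlocks G.Euu G.Euv (-(G.Euv).transpose) G.Evv

/-- The part of `C` in the long variables; the hypermomentum of the root vertex is left out. -/
def Cv (root : V) : Matrix Λ {v // v ≠ root} ℤ := Matrix.of fun l v => G.alternating v.1 (G.eta l)

/-- The part of `C` in the short variables. -/
def Cu (root : V) : Matrix Λ {v // v ≠ root} ℤ := Matrix.of fun l v => G.alternating v.1 (G.eps l)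

/-- The matrix `C` coupling short and long variables to hypermomenta. -/
def C (root : V) : Matrix (Λ ⊕ Λ) {v // v ≠ root} ℤ := Matrix.fromRows (G.Cu root) (G.Cv root)

/-- The indices of the quadratic form: short variables, long variables, hypermomenta. -/
abbrev Index (V Λ : Type*) (root : V) : Type _ := (Λ ⊕ Λ) ⊕ {v : V // v ≠ root}

/-- The integer oscillation matrix `B'`. -/
def Bprime (root : V) : Matrix (Index V Λ root) (Index V Λ root) ℤ :=
  Matrix.fromBlocks G.E (G.C root) (-(G.C root).transpose) 0

/-- The oscillation matrix `B`, with the parameter `s` in front of `E`. -/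
def B (root : V) (s : ℝ) : Matrix (Index V Λ root) (Index V Λ root) ℝ :=
  Matrix.fromBlocks (s • (G.E).map (Int.cast : ℤ → ℝ)) ((G.C root).map (Int.cast : ℤ → ℝ))
    (-((G.C root).map (Int.cast : ℤ → ℝ)).transpose) 0

/-- The propagator matrix `A`: `c_l = 1 / t_l` on the short variables, `t_l` on the long variables
and `0` on the hypermomenta. -/
def A (V : Type*) {Λ : Type*} [DecidableEq V] [DecidableEq Λ] (root : V) (t : Λ → ℝ) :
    Matrix (Index V Λ root) (Index V Λ root) ℝ :=
  Matrix.diagonal (Sum.elim (Sum.elim (fun l => 1 / t l) t) (fun _ => 0))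

/-- The first hyperbolic polynomial `HU_{G, root}` (evaluated at nonzero values of the `t_l`). -/
def HU (root : V) (s : ℝ) (t : Λ → ℝ) : ℝ :=
  (∏ l, t l) * (A V root t + G.B root s).det

/-- The matrix `B'` reduced to long variables and hypermomenta (all short variables deleted). -/
def reducedB (root : V) : Matrix (Λ ⊕ {v // v ≠ root}) (Λ ⊕ {v // v ≠ root}) ℤ :=
  Matrix.fromBlocks G.Evv (G.Cv root) (-(G.Cv root).transpose) 0

/-- The form taken by the reduced matrix for orientable graphs, written with the incidence matrix:
blocks `∑_{i ≠ j} ω(i,j) ε_{li} ε_{l'j}` and `± ∑_{i ∈ v} ε_{li}`. -/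
def reducedBOriented (root : V) : Matrix (Λ ⊕ {v // v ≠ root}) (Λ ⊕ {v // v ≠ root}) ℤ :=
  Matrix.fromBlocks
    (Matrix.of fun l l' => ∑ v, ∑ i : Fin (G.deg v), ∑ j : Fin (G.deg v),
      omega i j * G.eps l ⟨v, i⟩ * G.eps l' ⟨v, j⟩)
    (Matrix.of fun l v => ∑ i : Fin (G.deg v.1), G.eps l ⟨v.1, i⟩)
    (Matrix.of fun v l => -∑ i : Fin (G.deg v.1), G.eps l ⟨v.1, i⟩)
    0

/-! ### Pfaffians -/

/-- The permutation `σ` lists a pairing of `{0, …, m - 1}` in normal form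
`{σ 0, σ 1}, {σ 2, σ 3}, …`: inside every pair the smaller element comes first, and the pairs are
ordered by their first elements. -/
def IsPairing {m : ℕ} (σ : Equiv.Perm (Fin m)) : Prop :=
  (∀ i j : Fin m, Even (i : ℕ) → (j : ℕ) = i + 1 → σ i < σ j) ∧
    ∀ i j : Fin m, Even (i : ℕ) → (j : ℕ) = i + 2 → σ i < σ j

open Classical in
/-- The (triangular) Pfaffian: the sum, with signs, over all pairings of the indices of the products
of the corresponding matrix elements.  It is `0` in odd size. -/
def pfaffian {m : ℕ} (M : Matrix (Fin m) (Fin m) ℤ) : ℤ :=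
  if Even m then
    ∑ σ : Equiv.Perm (Fin m), if IsPairing σ then
      (Equiv.Perm.sign σ : ℤ) * ∏ i : Fin (m / 2),
        M (σ ⟨2 * i.1, by omega⟩) (σ ⟨2 * i.1 + 1, by omega⟩) else 0
  else 0

/-- The index survives when the short variables of `I` and the long variables of `J` are deleted. -/
def Kept (root : V) (I J : Finset Λ) : Index V Λ root → Prop
  | Sum.inl (Sum.inl l) => l ∉ I
  | Sum.inl (Sum.inr l) => l ∉ J
  | Sum.inr _ => True

/-- The number of surviving indices. -/
def size (root : V) (I J : Finset Λ) : ℕ := Nat.card {x : Index V Λ root // Kept root I J x}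

/-- An ordering of the surviving indices, for all `I` and `J`. -/
abbrev Ordering (V Λ : Type*) [Fintype V] [DecidableEq V] [Fintype Λ] [DecidableEq Λ]
    (root : V) : Type _ :=
  ∀ I J : Finset Λ, Fin (size root I J) ≃ {x : Index V Λ root // Kept root I J x}

/-- The integer `n_{I,J}`: the Pfaffian of `B'` with the lines and columns of the short variables
`I` and of the long variables `J` deleted, the remaining indices being ordered by `e`. -/
def nIJ (root : V) (e : Ordering V Λ root) (I J : Finset Λ) : ℤ :=
  pfaffian ((G.Bprime root).submatrix (fun k => (e I J k).1) (fun k => (e I J k).1))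

/-- `k_{I,J} = |I| + |J| - L - F + 1`. -/
def kIJ (I J : Finset Λ) : ℤ := (I.card : ℤ) + J.card - Fintype.card Λ - G.numFaces + 1

/-- `k_J = |J| - F + 1`. -/
def kJ (J : Finset Λ) : ℤ := (J.card : ℤ) - G.numFaces + 1

/-- The density (with respect to `∏ dt_l`) of the amplitude `A_{G, root}` in dimension `D = 4` with
vanishing external arguments, up to a constant: `∏ (1 - t_l ^ 2) ^ (D / 2 - 1) / HU ^ (D / 2)`. -/
def amplitudeDensity (root : V) (s : ℝ) (t : Λ → ℝ) : ℝ :=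
  (∏ l, (1 - t l ^ 2)) / G.HU root s t ^ 2

end FeynmanGraph

end NCQFT

end

/-! The heart of the matter is the reduced matrix on long variables and hypermomenta. Orientability
makes `(-1)^i` a product of corner signs, so a change of signs of the variables turns `reducedB`
into `-reducedBOriented`. A vector of long variables is a flow along the lines; the matrix
integrates this flow around each vertex, the hypermomenta serving as constants of integration, and
produces a potential on the corners. After factors of 2 are extracted (`integratedB`), the kernel
equations say that the potential agrees at `next c` and `opp c`, that is, that it is a function of
the faces.

With one face the potential is constant over every commutative ring, so `integratedB` is nonsingular
modulo every prime and has determinant `±1`. The extracted factors leave `2^(L-n+1) = 2^(2g)`, with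
a plus sign since the determinant of a skew integer matrix is a square (`pfaffian_sq`). With `F`
faces, the functions on the faces, normalised at the root, give a space of dimension `F - 1` in the
rational kernel.

Deleting all short variables and the long variables of `J` leaves the reduced matrix of the graph
without `J`, so `n_{I,J}` is nonzero exactly when that graph has one face. This is admissibility
(`admissible_iff`): one face forces both the graph without `J` and the dual graph restricted to `J`
to be connected, which supplies the trees, and contracting a tree does not change the number of
faces. Euler's inequality, a consequence of the orthogonality of face differences and vertex
differences, shows that a tree has one face and bounds the genus; the parity in Euler's relation
comes from the even size of a nonsingular skew matrix.

Expanding `det (A + B)` along the diagonal part writes `HU` with squared Pfaffians as coefficients.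
All terms are nonnegative for positive `t`, so keeping those with `I` full gives the lower bounds.
The matching upper bound on the scaling holds because all monomials of degree below `F - 1` vanish:
the kernel from the faces is then too large to be cut down to zero (`Orientable.nIJ_eq_zero`). -/

open scoped Topology

set_option linter.unusedSectionVars false

noncomputable section

namespace NCQFT

/-! ### Pfaffians and determinants -/

section Pfaffian

/-- The even and the odd elements of `{0, …, m - 1}`, arranged in consecutive pairs. -/
def pairEquiv {m : ℕ} (hm : Even m) : Fin (m / 2) × Bool ≃ Fin m where
  toFun p := ⟨2 * p.1 + p.2.toNat, by
    have := p.1.2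
    have := Bool.toNat_le p.2
    omega⟩
  invFun j := (⟨j / 2, by
    obtain ⟨r, rfl⟩ := hm
    have := j.2
    omega⟩, decide ((j : ℕ) % 2 = 1))
  left_inv := by
    rintro ⟨i, b⟩
    cases b
    · simp
    · ext
      · simp; omega
      · simp
  right_inv := by
    intro j
    ext
    rcases Nat.mod_two_eq_zero_or_one j with h | h
    · simp [h]; omega
    · simp [h]; omega

variable {m : ℕ} {K : Type*} [CommRing K]

/-- The product of the matrix elements over the pairs listed by `c`. -/
def pairProd (hm : Even m) (M : Matrix (Fin m) (Fin m) K) (c : Fin m → Fin m) : K :=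
  ∏ i : Fin (m / 2), M (c (pairEquiv hm (i, false))) (c (pairEquiv hm (i, true)))

/-- The Pfaffian without normalisation: the sum over all permutations. -/
def fullPfaffian (hm : Even m) (M : Matrix (Fin m) (Fin m) K) : K :=
  ∑ σ : Equiv.Perm (Fin m), (Equiv.Perm.sign σ : ℤ) * pairProd hm M σ

theorem prod_pairEquiv (hm : Even m) (f : Fin m → K) :
    ∏ j, f j = ∏ i, (f (pairEquiv hm (i, false)) * f (pairEquiv hm (i, true))) := by
  rw [← (pairEquiv hm).prod_comp, Fintype.prod_prod_type]
  simp [mul_comm]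

theorem pairProd_congruence (hm : Even m) (A M : Matrix (Fin m) (Fin m) K) (σ : Fin m → Fin m) :
    pairProd hm (A * M * A.transpose) σ =
      ∑ c : Fin m → Fin m, pairProd hm M c * ∏ j, A (σ j) (c j) := by
  have h1 : pairProd hm (A * M * A.transpose) σ =
      ∏ i : Fin (m / 2), ∑ p : Fin m × Fin m,
        M p.1 p.2 * (A (σ (pairEquiv hm (i, false))) p.1 *
          A (σ (pairEquiv hm (i, true))) p.2) := by
    refine Finset.prod_congr rfl fun i _ => ?_
    rw [Fintype.sum_prod_type, Finset.sum_comm]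
    simp only [Matrix.mul_apply, Matrix.transpose_apply, Finset.sum_mul]
    refine Finset.sum_congr rfl fun a _ => Finset.sum_congr rfl fun b _ => ?_
    ring
  rw [h1, Finset.prod_univ_sum, Fintype.piFinset_univ]
  let e : (Fin m → Fin m) ≃ (Fin (m / 2) → Fin m × Fin m) :=
    { toFun := fun c i => (c (pairEquiv hm (i, false)), c (pairEquiv hm (i, true)))
      invFun := fun p j => bif ((pairEquiv hm).symm j).2 then (p ((pairEquiv hm).symm j).1).2
        else (p ((pairEquiv hm).symm j).1).1
      left_inv := by
        intro c
        funext j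
        obtain ⟨⟨i, b⟩, rfl⟩ := (pairEquiv hm).surjective j
        cases b <;> simp
      right_inv := by
        intro p
        funext i
        simp }
  rw [← e.sum_comp]
  refine Finset.sum_congr rfl fun c _ => ?_
  rw [Finset.prod_mul_distrib, prod_pairEquiv hm (fun j => A (σ j) (c j))]
  rfl

/-- A Cauchy–Binet argument: for a fixed choice `c` of summation indices, the signed sum over `σ` is
the determinant of the columns of `A` listed by `c`. It vanishes if `c` repeats a column, and is
`sign c * det A` if `c` is a permutation. -/
theorem fullPfaffian_congruence (hm : Even m) (A M : Matrix (Fin m) (Fin m) K) :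
    fullPfaffian hm (A * M * A.transpose) = A.det * fullPfaffian hm M := by
  have h1 : fullPfaffian hm (A * M * A.transpose) =
      ∑ c : Fin m → Fin m, pairProd hm M c * (A.submatrix id c).det := by
    simp only [fullPfaffian, pairProd_congruence, Finset.mul_sum]
    rw [Finset.sum_comm]
    refine Finset.sum_congr rfl fun c _ => ?_
    rw [Matrix.det_apply', Finset.mul_sum]
    refine Finset.sum_congr rfl fun σ _ => ?_
    simp only [Matrix.submatrix_apply, id]
    ring
  have h2 : ∀ c : Fin m → Fin m, ¬ Function.Bijective c → (A.submatrix id c).det = 0 := by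
    intro c hc
    rw [← Finite.injective_iff_bijective] at hc
    simp only [Function.Injective, not_forall] at hc
    obtain ⟨a, b, hab, hne⟩ := hc
    exact Matrix.det_zero_of_column_eq hne fun i => by simp [hab]
  rw [h1, fullPfaffian, Finset.mul_sum]
  symm
  refine Finset.sum_of_injOn (fun σ : Equiv.Perm (Fin m) => (σ : Fin m → Fin m))
    (fun σ _ τ _ h => Equiv.coe_fn_injective h) (by simp) ?_ ?_
  · intro c _ hc
    rw [h2 c, mul_zero]
    intro hb
    exact hc ⟨Equiv.ofBijective c hb, by simp, rfl⟩
  · intro σ _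
    rw [Matrix.det_permute']
    ring

/-- The symmetries of the list of pairs: permute the pairs, and exchange the two members of some. -/
def pairPerm (hm : Even m) (h : Equiv.Perm (Fin (m / 2)) × (Fin (m / 2) → Bool)) :
    Equiv.Perm (Fin m) :=
  (pairEquiv hm).permCongr
    ((Equiv.prodCongr h.1 (Equiv.refl Bool)) *
      Equiv.prodShear (Equiv.refl _) (fun i => if h.2 i then Equiv.boolNot else Equiv.refl Bool))

theorem pairPerm_apply (hm : Even m) (h : Equiv.Perm (Fin (m / 2)) × (Fin (m / 2) → Bool))
    (i : Fin (m / 2)) (b : Bool) :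
    pairPerm hm h (pairEquiv hm (i, b)) = pairEquiv hm (h.1 i, xor (h.2 i) b) := by
  simp only [pairPerm, Equiv.permCongr_apply, Equiv.symm_apply_apply]
  cases hh : h.2 i <;> simp [Equiv.prodShear, hh]

theorem sign_pairPerm (hm : Even m) (h : Equiv.Perm (Fin (m / 2)) × (Fin (m / 2) → Bool)) :
    Equiv.Perm.sign (pairPerm hm h) = ∏ i, if h.2 i then -1 else 1 := by
  rw [pairPerm, Equiv.Perm.sign_permCongr, Equiv.Perm.sign_mul]
  have h1 : Equiv.Perm.sign (Equiv.prodCongr h.1 (Equiv.refl Bool)) = 1 := by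
    have := Equiv.Perm.sign_prodCongrLeft (α := Bool) (fun _ => h.1)
    have h2 : Equiv.prodCongrLeft (fun _ : Bool => h.1) = Equiv.prodCongr h.1 (Equiv.refl Bool) := by
      ext ⟨a, b⟩ <;> rfl
    rw [h2] at this
    rw [this]
    simp
  have h3 : Equiv.prodShear (Equiv.refl _)
        (fun i => if h.2 i then Equiv.boolNot else Equiv.refl Bool) =
      Equiv.prodCongrRight (fun i => if h.2 i then Equiv.boolNot else Equiv.refl Bool) := by
    ext ⟨a, b⟩ <;> rfl
  rw [h1, h3, one_mul, Equiv.Perm.sign_prodCongrRight]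
  refine Finset.prod_congr rfl fun i _ => ?_
  split_ifs
  · decide
  · exact Equiv.Perm.sign_refl

/-- An exchange inside a pair changes both the sign of the permutation and, by skewness, the sign of
the product; a permutation of the pairs changes neither. The summand of `fullPfaffian` is thus
constant on the cosets of these symmetries. -/
theorem sign_mul_pairProd (hm : Even m) (M : Matrix (Fin m) (Fin m) K)
    (hM : ∀ i j, M i j = -M j i) (h : Equiv.Perm (Fin (m / 2)) × (Fin (m / 2) → Bool))
    (σ : Equiv.Perm (Fin m)) :
    ((Equiv.Perm.sign (σ * pairPerm hm h) : ℤ) : K) * pairProd hm M (⇑(σ * pairPerm hm h)) =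
      (Equiv.Perm.sign σ : ℤ) * pairProd hm M σ := by
  have h1 : pairProd hm M (⇑(σ * pairPerm hm h)) =
      (∏ i, if h.2 i then -1 else 1) * pairProd hm M σ := by
    rw [pairProd, pairProd, ← Equiv.prod_comp h.1 (fun i => M (σ (pairEquiv hm (i, false))) (σ (pairEquiv hm (i, true)))), ← Finset.prod_mul_distrib]
    refine Finset.prod_congr rfl fun i _ => ?_
    simp only [Equiv.Perm.mul_apply, pairPerm_apply]
    cases h.2 i
    · simp
    · simp [hM (σ (pairEquiv hm (h.1 i, true)))]
  have h2 : ((Equiv.Perm.sign (pairPerm hm h) : ℤ) : K) * (∏ i, if h.2 i then -1 else 1) = 1 := by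
    rw [sign_pairPerm]
    push_cast
    rw [← Finset.prod_mul_distrib]
    refine Finset.prod_eq_one fun i _ => ?_
    split_ifs <;> simp
  rw [h1, Equiv.Perm.sign_mul]
  push_cast
  linear_combination ((Equiv.Perm.sign σ : ℤ) : K) * pairProd hm M σ * h2

open FeynmanGraph

theorem isPairing_iff (hm : Even m) (σ : Equiv.Perm (Fin m)) :
    IsPairing σ ↔
      (∀ i, σ (pairEquiv hm (i, false)) < σ (pairEquiv hm (i, true))) ∧
        StrictMono fun i => σ (pairEquiv hm (i, false)) := by
  constructor
  · rintro ⟨h1, h2⟩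
    refine ⟨fun i => h1 _ _ (by simp [pairEquiv]) (by simp [pairEquiv]), ?_⟩
    have key : ∀ d : ℕ, ∀ i j : Fin (m / 2), (j : ℕ) = i + d + 1 →
        σ (pairEquiv hm (i, false)) < σ (pairEquiv hm (j, false)) := by
      intro d
      induction d with
      | zero =>
        intro i j hij
        exact h2 _ _ (by simp [pairEquiv]) (by simp [pairEquiv]; omega)
      | succ d ih =>
        intro i j hij
        have hlt : (i : ℕ) + d + 1 < m / 2 := by omega
        exact (ih i ⟨i + d + 1, hlt⟩ rfl).trans
          (h2 _ _ (by simp [pairEquiv]) (by simp [pairEquiv]; omega))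
    intro i j hij
    exact key (j - i - 1) i j (by have : (i : ℕ) < j := hij; omega)
  · rintro ⟨h1, h2⟩
    constructor
    · intro i j hi hij
      obtain ⟨⟨a, b⟩, rfl⟩ := (pairEquiv hm).surjective i
      obtain ⟨⟨a', b'⟩, rfl⟩ := (pairEquiv hm).surjective j
      cases b <;> cases b' <;> simp [pairEquiv] at hi hij
      · omega
      · have : a = a' := by ext; omega
        subst this
        exact h1 a
    · intro i j hi hij
      obtain ⟨⟨a, b⟩, rfl⟩ := (pairEquiv hm).surjective i
      obtain ⟨⟨a', b'⟩, rfl⟩ := (pairEquiv hm).surjective j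
      cases b <;> cases b' <;> simp [pairEquiv] at hi hij
      · exact h2 (by show (a : ℕ) < a'; omega)
      · omega

/-- Normal form is reached by sorting twice: `s` marks the pairs listed in decreasing order, and `ρ`
sorts the pairs by their smaller elements `a`. -/
theorem exists_isPairing_mul (hm : Even m) (τ : Equiv.Perm (Fin m)) :
    ∃ σ h, IsPairing σ ∧ σ * pairPerm hm h = τ := by
  let s : Fin (m / 2) → Bool :=
    fun i => decide (τ (pairEquiv hm (i, true)) < τ (pairEquiv hm (i, false)))
  let a : Fin (m / 2) → Fin m := fun i => τ (pairEquiv hm (i, s i))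
  have ha : Function.Injective a := by
    intro i j hij
    have := (pairEquiv hm).injective (τ.injective hij)
    exact (Prod.ext_iff.1 this).1
  let ρ := Tuple.sort a
  have hmono : StrictMono (a ∘ ρ) :=
    (Tuple.monotone_sort a).strictMono_of_injective (ha.comp ρ.injective)
  refine ⟨τ * (pairPerm hm (ρ.symm, s))⁻¹, (ρ.symm, s), ?_, by simp⟩
  have hinv : ∀ i b, (pairPerm hm (ρ.symm, s))⁻¹ (pairEquiv hm (i, b)) =
      pairEquiv hm (ρ i, xor (s (ρ i)) b) := by
    intro i b
    rw [Equiv.Perm.inv_eq_iff_eq, pairPerm_apply]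
    simp
  rw [isPairing_iff hm]
  refine ⟨fun i => ?_, fun i j hij => ?_⟩
  · simp only [Equiv.Perm.mul_apply, hinv]
    by_cases h : τ (pairEquiv hm (ρ i, true)) < τ (pairEquiv hm (ρ i, false))
    · have hs : s (ρ i) = true := by simp [s, h]
      simpa [hs] using h
    · have hs : s (ρ i) = false := by simpa [s] using h
      have hne : τ (pairEquiv hm (ρ i, true)) ≠ τ (pairEquiv hm (ρ i, false)) := by
        intro h'
        have := (pairEquiv hm).injective (τ.injective h')
        simp at this
      simpa [hs] using lt_of_le_of_ne (not_lt.1 h) hne.symm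
  · simpa [Equiv.Perm.mul_apply, hinv] using hmono hij

/-- The increasing order inside the pairs determines the exchanges. The two increasing lists of
first elements then have the same range, hence coincide, which determines the permutation of the
pairs. -/
theorem isPairing_mul_unique (hm : Even m) {σ σ' : Equiv.Perm (Fin m)}
    {h h' : Equiv.Perm (Fin (m / 2)) × (Fin (m / 2) → Bool)} (hσ : IsPairing σ)
    (hσ' : IsPairing σ') (heq : σ * pairPerm hm h = σ' * pairPerm hm h') : σ = σ' ∧ h = h' := by
  rw [isPairing_iff hm] at hσ hσ'
  have key : ∀ i b, σ (pairEquiv hm (h.1 i, xor (h.2 i) b)) =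
      σ' (pairEquiv hm (h'.1 i, xor (h'.2 i) b)) := by
    intro i b
    rw [← pairPerm_apply, ← pairPerm_apply, ← Equiv.Perm.mul_apply, heq, Equiv.Perm.mul_apply]
  have h2 : h.2 = h'.2 := by
    funext i
    have k0 := key i false
    have k1 := key i true
    have l := hσ.1 (h.1 i)
    have l' := hσ'.1 (h'.1 i)
    cases e : h.2 i <;> cases e' : h'.2 i <;> simp [e, e'] at k0 k1 ⊢
    · rw [k0, k1] at l
      exact absurd l l'.asymm
    · rw [k0, k1] at l
      exact absurd l l'.asymm
  have key2 : ∀ i, σ (pairEquiv hm (h.1 i, false)) = σ' (pairEquiv hm (h'.1 i, false)) := by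
    intro i
    have k := key i (h.2 i)
    rw [← h2] at k
    simpa using k
  have hr : Set.range (fun i => σ (pairEquiv hm (i, false))) =
      Set.range (fun i => σ' (pairEquiv hm (i, false))) := by
    ext x
    constructor
    · rintro ⟨i, rfl⟩
      exact ⟨h'.1 (h.1.symm i), by simp [← key2]⟩
    · rintro ⟨i, rfl⟩
      exact ⟨h.1 (h'.1.symm i), by simp [key2]⟩
  have hfun : (fun i => σ (pairEquiv hm (i, false))) = fun i => σ' (pairEquiv hm (i, false)) :=
    (StrictMono.range_inj hσ.2 hσ'.2).1 hr
  have h1 : h.1 = h'.1 := by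
    ext i : 1
    have k := key2 i
    have : σ (pairEquiv hm (h.1 i, false)) = σ' (pairEquiv hm (h.1 i, false)) :=
      congrFun hfun (h.1 i)
    rw [this] at k
    have := (pairEquiv hm).injective (σ'.injective k)
    exact (Prod.ext_iff.1 this).1
  have hh : h = h' := Prod.ext h1 h2
  subst hh
  exact ⟨mul_right_cancel heq, rfl⟩

open Classical in
theorem pfaffian_of_even (hm : Even m) (M : Matrix (Fin m) (Fin m) ℤ) :
    pfaffian M = ∑ σ : {σ : Equiv.Perm (Fin m) // IsPairing σ},
      (Equiv.Perm.sign σ.1 : ℤ) * pairProd hm M σ.1 := by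
  rw [pfaffian, if_pos hm, ← Finset.sum_filter]
  rw [Finset.sum_subtype _ (p := IsPairing) (by simp)]
  rfl

-- Normal forms are representatives of the cosets of the pair symmetries, and the summand is
-- constant on each coset.
open Classical in
theorem fullPfaffian_eq (hm : Even m) (M : Matrix (Fin m) (Fin m) ℤ)
    (hM : ∀ i j, M i j = -M j i) :
    fullPfaffian hm M =
      Fintype.card (Equiv.Perm (Fin (m / 2)) × (Fin (m / 2) → Bool)) * pfaffian M := by
  let e : (Equiv.Perm (Fin (m / 2)) × (Fin (m / 2) → Bool)) ×
      {σ : Equiv.Perm (Fin m) // IsPairing σ} ≃ Equiv.Perm (Fin m) :=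
    Equiv.ofBijective (fun p => p.2.1 * pairPerm hm p.1) (by
      constructor
      · rintro ⟨h, σ, hσ⟩ ⟨h', σ', hσ'⟩ heq
        obtain ⟨rfl, rfl⟩ := isPairing_mul_unique hm hσ hσ' heq
        rfl
      · intro τ
        obtain ⟨σ, h, hσ, rfl⟩ := exists_isPairing_mul hm τ
        exact ⟨(h, ⟨σ, hσ⟩), rfl⟩)
  rw [fullPfaffian, ← e.sum_comp, Fintype.sum_prod_type, pfaffian_of_even hm,
    ← nsmul_eq_mul, Fintype.card, ← Finset.sum_const]
  refine Finset.sum_congr rfl fun h _ => Finset.sum_congr rfl fun σ _ => ?_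
  have := sign_mul_pairProd hm M hM h σ.1
  simp only [Int.cast_id] at this
  exact this

/-- The standard symplectic matrix. -/
def symplectic (hm : Even m) : Matrix (Fin m) (Fin m) ℤ :=
  Matrix.of fun a b =>
    if ((pairEquiv hm).symm a).1 = ((pairEquiv hm).symm b).1 then
      (((pairEquiv hm).symm b).2.toNat : ℤ) - ((pairEquiv hm).symm a).2.toNat else 0

theorem symplectic_skew (hm : Even m) (i j : Fin m) :
    symplectic hm i j = -symplectic hm j i := by
  simp only [symplectic, Matrix.of_apply, eq_comm (a := ((pairEquiv hm).symm j).1)]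
  split_ifs <;> simp

theorem det_symplectic (hm : Even m) : (symplectic hm).det = 1 := by
  have h : (symplectic hm).submatrix ((Equiv.prodComm _ _).trans (pairEquiv hm))
      ((Equiv.prodComm _ _).trans (pairEquiv hm)) =
      Matrix.blockDiagonal (fun _ : Fin (m / 2) =>
        (Matrix.of fun a b : Bool => (b.toNat : ℤ) - a.toNat)) := by
    ext ⟨a, i⟩ ⟨b, j⟩
    simp [symplectic, Matrix.blockDiagonal_apply]
  rw [← Matrix.det_submatrix_equiv_self ((Equiv.prodComm _ _).trans (pairEquiv hm)), h,
    Matrix.det_blockDiagonal]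
  refine Finset.prod_eq_one fun i _ => ?_
  rw [← Matrix.det_submatrix_equiv_self finTwoEquiv, Matrix.det_fin_two]
  simp [finTwoEquiv]

theorem pfaffian_symplectic (hm : Even m) : pfaffian (symplectic hm) = 1 := by
  have hone : IsPairing (1 : Equiv.Perm (Fin m)) :=
    ⟨fun i j _ h => by show (i : ℕ) < j; omega, fun i j _ h => by show (i : ℕ) < j; omega⟩
  rw [pfaffian_of_even hm, Finset.sum_eq_single ⟨1, hone⟩]
  · simp [pairProd, symplectic]
  · rintro ⟨σ, hσ⟩ _ hne
    rw [mul_eq_zero]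
    right
    by_contra h0
    apply hne
    simp only [pairProd] at h0
    rw [Finset.prod_eq_zero_iff] at h0
    push Not at h0
    rw [isPairing_iff hm] at hσ
    -- A nonzero product forces every pair of `σ` to be a standard pair, and `σ (pairEquiv hm (i,
    -- false)) < σ (pairEquiv hm (i, true))` forces it to be in the standard order.
    have key : ∀ i, ∃ j, σ (pairEquiv hm (i, false)) = pairEquiv hm (j, false) ∧
        σ (pairEquiv hm (i, true)) = pairEquiv hm (j, true) := by
      intro i
      have h1 := h0 i (Finset.mem_univ _)
      have h2 := hσ.1 i
      obtain ⟨⟨a, b⟩, h⟩ := (pairEquiv hm).surjective (σ (pairEquiv hm (i, false)))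
      obtain ⟨⟨a', b'⟩, h'⟩ := (pairEquiv hm).surjective (σ (pairEquiv hm (i, true)))
      rw [← h, ← h'] at h1 h2
      simp only [symplectic, Matrix.of_apply, Equiv.symm_apply_apply, ne_eq, ite_eq_right_iff,
        Classical.not_imp] at h1
      obtain ⟨rfl, h1⟩ := h1
      cases b <;> cases b' <;> simp [pairEquiv] at h1 h2
      exact ⟨a, h.symm, h'.symm⟩
    choose f hf using key
    have hf' : f = id := by
      have hmono : StrictMono f := by
        intro i j hij
        have := hσ.2 hij
        simp only [(hf _).1] at this
        have h' : 2 * (f i : ℕ) < 2 * f j := by simpa [pairEquiv] using this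
        show (f i : ℕ) < f j
        omega
      have hs : Function.Surjective f := Finite.surjective_of_injective hmono.injective
      exact (StrictMono.range_inj hmono strictMono_id).1 (by simp [hs.range_eq])
    refine Subtype.ext (Equiv.ext fun j => ?_)
    obtain ⟨⟨i, b⟩, rfl⟩ := (pairEquiv hm).surjective j
    have := hf i
    rw [hf'] at this
    cases b
    · exact this.1
    · exact this.2
  · simp

/-- A skew-symmetric matrix supported on few indices is a sum of few elementary ones. -/
theorem exists_sum_wedge {ι F : Type*} [DecidableEq ι] [Field F] (k : ℕ) :
    ∀ (s : Finset ι) (M : ι → ι → F), s.card ≤ 2 * k → (∀ i j, M i j = -M j i) →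
      (∀ i, M i i = 0) → (∀ i j, i ∉ s → M i j = 0) →
      ∃ v w : Fin k → ι → F, ∀ i j, M i j = ∑ l, (v l i * w l j - w l i * v l j) := by
  induction k with
  | zero =>
    intro s M hs _ _ h0
    have : s = ∅ := Finset.card_eq_zero.1 (by omega)
    subst this
    exact ⟨fun _ _ => 0, fun _ _ => 0, fun i j => by simp [h0 i j]⟩
  | succ k ih =>
    intro s M hs hskew hdiag h0
    by_cases hz : ∀ a b, M a b = 0
    · exact ⟨fun _ _ => 0, fun _ _ => 0, fun i j => by simp [hz]⟩
    push Not at hz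
    obtain ⟨a, b, hab⟩ := hz
    have hne : a ≠ b := by
      rintro rfl
      exact hab (hdiag a)
    have has : a ∈ s := by
      by_contra h
      exact hab (h0 a b h)
    have hbs : b ∈ s := by
      by_contra h
      exact hab (by rw [hskew, h0 b a h, neg_zero])
    -- One step of symplectic Gram–Schmidt: the subtracted form agrees with `M` in the rows `a` and
    -- `b`, so the support loses two indices.
    let M' : ι → ι → F := fun i j => M i j - (M i a * M j b - M i b * M j a) / M a b
    obtain ⟨v, w, hvw⟩ := ih ((s.erase a).erase b) M'
      (by
        rw [Finset.card_erase_of_mem (Finset.mem_erase.2 ⟨hne.symm, hbs⟩),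
          Finset.card_erase_of_mem has]
        omega)
      (by
        intro i j
        simp only [M']
        rw [hskew i j]
        ring)
      (by
        intro i
        simp only [M', hdiag]
        ring)
      (by
        intro i j hi
        simp only [M']
        by_cases h1 : i = b
        · subst h1
          rw [hdiag, hskew i a, hskew i j]
          field_simp
          ring
        · by_cases h2 : i = a
          · subst h2
            rw [hdiag, hskew i j]
            field_simp
            ring
          · have : i ∉ s := fun h => hi (by simp [h1, h2, h])
            simp [h0 i _ this])
    refine ⟨Fin.cons (fun i => M i a / M a b) v, Fin.cons (fun i => M i b) w, fun i j => ?_⟩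
    rw [Fin.sum_univ_succ]
    simp only [Fin.cons_zero, Fin.cons_succ, ← hvw, M']
    ring

-- In even size, over `ℚ`, `M = A * S * Aᵀ` with `S` the standard symplectic matrix, even when `M`
-- is degenerate. Since `S` has Pfaffian and determinant 1, the Pfaffian of `M` is `det A` and its
-- determinant is `(det A)^2`. In odd size both sides vanish.
open Classical in
theorem pfaffian_sq (M : Matrix (Fin m) (Fin m) ℤ) (hM : ∀ i j, M i j = -M j i) :
    pfaffian M ^ 2 = M.det := by
  rcases Nat.even_or_odd m with hm | hm
  · obtain ⟨v, w, hvw⟩ := exists_sum_wedge (F := ℚ) (m / 2) (Finset.univ : Finset (Fin m))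
      (fun i j => (M i j : ℚ)) (by simp; obtain ⟨r, rfl⟩ := hm; omega)
      (fun i j => by exact_mod_cast hM i j)
      (fun i => by have := hM i i; have : M i i = 0 := by omega
                   exact_mod_cast this)
      (by simp)
    let A : Matrix (Fin m) (Fin m) ℚ := Matrix.of fun i j =>
      bif ((pairEquiv hm).symm j).2 then w ((pairEquiv hm).symm j).1 i
        else v ((pairEquiv hm).symm j).1 i
    have hA : M.map (Int.cast : ℤ → ℚ) =
        A * (symplectic hm).map (Int.cast : ℤ → ℚ) * A.transpose := by
      ext i j
      rw [Matrix.map_apply, hvw, Matrix.mul_apply, ← (pairEquiv hm).sum_comp,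
        Fintype.sum_prod_type]
      refine Finset.sum_congr rfl fun l _ => ?_
      simp only [Matrix.mul_apply, ← (pairEquiv hm).sum_comp, Fintype.sum_prod_type]
      simp [A, symplectic, apply_ite (Int.cast : ℤ → ℚ)]
      ring
    have hcast : ∀ X : Matrix (Fin m) (Fin m) ℤ,
        ((fullPfaffian hm X : ℤ) : ℚ) = fullPfaffian hm (X.map (Int.cast : ℤ → ℚ)) := by
      intro X
      simp [fullPfaffian, pairProd]
    have hpf : (pfaffian M : ℚ) = A.det := by
      have h1 := hcast M
      rw [hA, fullPfaffian_congruence, ← hcast, fullPfaffian_eq hm _ hM,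
        fullPfaffian_eq hm _ (symplectic_skew hm), pfaffian_symplectic] at h1
      push_cast at h1
      have hc : ((Fintype.card (Equiv.Perm (Fin (m / 2)) × (Fin (m / 2) → Bool)) : ℕ) : ℚ) ≠ 0 := by
        exact_mod_cast Fintype.card_ne_zero
      rw [mul_one, mul_comm A.det] at h1
      exact mul_left_cancel₀ hc h1
    have hdet : ((M.det : ℤ) : ℚ) = A.det ^ 2 := by
      have h1 : ((M.det : ℤ) : ℚ) = (M.map (Int.cast : ℤ → ℚ)).det :=
        (Int.castRingHom ℚ).map_det M
      have h2 : (((symplectic hm).det : ℤ) : ℚ) = ((symplectic hm).map (Int.cast : ℤ → ℚ)).det :=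
        (Int.castRingHom ℚ).map_det _
      rw [h1, hA, Matrix.det_mul, Matrix.det_mul, Matrix.det_transpose, ← h2, det_symplectic]
      push_cast
      ring
    have : ((pfaffian M ^ 2 : ℤ) : ℚ) = ((M.det : ℤ) : ℚ) := by
      rw [hdet, ← hpf]
      push_cast
      ring
    exact_mod_cast this
  · rw [pfaffian, if_neg (Nat.not_even_iff_odd.2 hm)]
    have h1 : M.transpose = -M := by
      ext i j
      simpa using hM j i
    have h2 : M.det = -M.det := by
      conv_lhs => rw [← Matrix.det_transpose, h1, Matrix.det_neg, Fintype.card_fin, hm.neg_one_pow]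
      ring
    omega

end Pfaffian

/-! ### Expansion of the determinant of the sum of a diagonal matrix and a matrix -/

section DiagonalExpansion

variable {ι K : Type*} [Fintype ι] [DecidableEq ι] [CommRing K]

theorem det_piecewise_diagonal (a : ι → K) (B : Matrix ι ι K) (s : Finset ι) :
    Matrix.det (Matrix.of fun i j => if i ∈ s then Matrix.diagonal a i j else B i j) =
      (∏ i ∈ s, a i) *
        (B.submatrix (Subtype.val : {i // i ∉ s} → ι) (Subtype.val : {i // i ∉ s} → ι)).det := by
  rw [Matrix.twoBlockTriangular_det _ (fun i => i ∉ s)]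
  · rw [mul_comm]
    congr 1
    · have h : (Matrix.of fun i j => if i ∈ s then Matrix.diagonal a i j else
          B i j).toSquareBlockProp (fun i => ¬ i ∉ s) =
          Matrix.diagonal fun i : {i // ¬ i ∉ s} => a i := by
        ext i j
        have hi : (i : ι) ∈ s := not_not.1 i.2
        simp [Matrix.toSquareBlockProp_def, hi, Matrix.diagonal_apply, Subtype.ext_iff]
      rw [h, Matrix.det_diagonal, ← Finset.prod_subtype s (p := fun i => ¬ i ∉ s) (by simp) a]
    · congr 1
      ext i j
      have hi : (i : ι) ∉ s := i.2
      simp [Matrix.toSquareBlockProp_def, hi]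
  · intro i hi j hj
    have hi' : i ∈ s := not_not.1 hi
    have hne : i ≠ j := by
      rintro rfl
      exact hj hi'
    simp [hi', hne]

/-- Multilinearity in the rows: each row comes either from the diagonal matrix or from `B`. The rows
from the diagonal make the determinant block triangular and leave a principal minor of `B`. -/
theorem det_diagonal_add (a : ι → K) (B : Matrix ι ι K) :
    (Matrix.diagonal a + B).det = ∑ s : Finset ι, (∏ i ∈ s, a i) *
        (B.submatrix (Subtype.val : {i // i ∉ s} → ι) (Subtype.val : {i // i ∉ s} → ι)).det := by
  have h := (Matrix.detRowAlternating (n := ι) (R := K)).toMultilinearMap.map_add_univ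
    (Matrix.diagonal a) B
  refine h.trans (Finset.sum_congr rfl fun s _ => ?_)
  rw [← det_piecewise_diagonal]
  refine congrArg Matrix.det ?_
  ext i j
  simp only [Finset.piecewise, Matrix.of_apply]
  split_ifs <;> rfl

end DiagonalExpansion

/-! ### Connectedness and spanning trees -/

/-- Connectedness is used below through invariant properties instead of chains of lines; in this
form it transfers easily between vertices, faces and corners. -/
theorem eqvGen_forall_iff {V : Type*} (r : V → V → Prop) :
    (∀ x y, Relation.EqvGen r x y) ↔
      ∀ P : V → Prop, (∀ x y, r x y → (P x ↔ P y)) → ∀ x y, P x → P y := by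
  constructor
  · intro h P hP x y
    have key : ∀ x y, Relation.EqvGen r x y → (P x ↔ P y) := by
      intro x y hxy
      induction hxy with
      | rel x y h => exact hP x y h
      | refl x => exact Iff.rfl
      | symm x y _ ih => exact ih.symm
      | trans x y z _ _ ih1 ih2 => exact ih1.trans ih2
    exact (key x y (h x y)).1
  · intro h x y
    refine h (fun z => Relation.EqvGen r x z) (fun a b hab => ?_) x y (.refl x)
    exact ⟨fun h => .trans _ _ _ h (.rel _ _ hab),
      fun h => .trans _ _ _ h (.symm _ _ (.rel _ _ hab))⟩

/-- The lines of `T` connect all the vertices, in terms of properties of vertices which are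
invariant along the lines of `T`. -/
def Connects {V Λ : Type*} (a b : Λ → V) (T : Finset Λ) : Prop :=
  ∀ P : V → Prop, (∀ l ∈ T, P (a l) ↔ P (b l)) → ∀ x y, P x → P y

theorem isSpanningTree_iff {V Λ : Type*} (a b : Λ → V) (T : Finset Λ) :
    IsSpanningTree a b T ↔ Connects a b T ∧ T.card + 1 = Nat.card V := by
  rw [IsSpanningTree, eqvGen_forall_iff, Connects]
  refine and_congr_left fun _ => forall_congr' fun P => imp_congr_left ?_
  exact ⟨fun h l hl => h _ _ ⟨l, hl, rfl, rfl⟩, by rintro h _ _ ⟨l, hl, rfl, rfl⟩; exact h l hl⟩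

/-- The differences of a function on the vertices along the lines of `T`, and its value at `v`. -/
def gradient {V Λ : Type*} (a b : Λ → V) (T : Finset Λ) (v : V) :
    (V → ℚ) →ₗ[ℚ] (T → ℚ) × ℚ where
  toFun q := (fun l => q (b l) - q (a l), q v)
  map_add' q q' := by
    ext l
    · simp only [Pi.add_apply, Prod.fst_add]; ring
    · rfl
  map_smul' r q := by
    ext l
    · simp only [Pi.smul_apply, smul_eq_mul, RingHom.id_apply, Prod.smul_fst]; ring
    · rfl

theorem Connects.gradient_injective {V Λ : Type*} {a b : Λ → V} {T : Finset Λ}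
    (h : Connects a b T) (v : V) : Function.Injective (gradient a b T v) := by
  rw [← LinearMap.ker_eq_bot, LinearMap.ker_eq_bot']
  intro q hq
  have h1 : ∀ l : T, q (b l) - q (a l) = 0 := fun l => congrFun (congrArg Prod.fst hq) l
  have h2 : q v = 0 := congrArg Prod.snd hq
  funext x
  refine h (fun x => q x = 0) (fun l hl => ?_) v x h2
  have := h1 ⟨l, hl⟩
  rw [sub_eq_zero] at this
  simp only [this]

/-- A minimal connecting set is a tree. Connectedness makes `gradient` injective and minimality
makes it surjective, so comparing dimensions gives `card V = card T + 1` without any discussion of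
loops. -/
theorem Connects.exists_isSpanningTree {V Λ : Type*} [Finite V] [Nonempty V]
    {a b : Λ → V} {S : Finset Λ} (h : Connects a b S) : ∃ T ⊆ S, IsSpanningTree a b T := by
  classical
  have := Fintype.ofFinite V
  obtain ⟨T, hTS, hT⟩ := exists_minimal_le_of_wellFoundedLT (Connects a b) S h
  refine ⟨T, hTS, (isSpanningTree_iff a b T).2 ⟨hT.prop, ?_⟩⟩
  obtain ⟨v⟩ := ‹Nonempty V›
  have hinj := hT.prop.gradient_injective v
  have hsurj : Function.Surjective (gradient a b T v) := by
    rw [← LinearMap.range_eq_top, eq_top_iff]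
    have hbasis : ∀ l : T, ∃ q, gradient a b T v q = (Pi.single l 1, 0) := by
      intro l
      have hn : ¬ Connects a b (T.erase l) := fun hc =>
        Finset.notMem_erase l.1 T (hT.le_of_le hc (Finset.erase_subset _ _) l.2)
      simp only [Connects, not_forall] at hn
      obtain ⟨P, hP, x, y, hx, hy⟩ := hn
      have hl : ¬ (P (a l) ↔ P (b l)) := by
        intro hl
        refine hy (hT.prop P (fun l' hl' => ?_) x y hx)
        by_cases he : l' = l
        · rw [he]; exact hl
        · exact hP l' (Finset.mem_erase.2 ⟨he, hl'⟩)
      -- Without `l` the set is disconnected; the indicator of a separated part jumps across `l` and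
      -- across no other line of `T`.
      let q : V → ℚ := fun z => if P z then 1 else 0
      have hq : q (b l) - q (a l) ≠ 0 := by
        simp only [q]
        by_cases h1 : P (a l) <;> by_cases h2 : P (b l) <;> simp_all
      refine ⟨fun z => (q (b l) - q (a l))⁻¹ * (q z - q v), ?_⟩
      refine Prod.ext (funext fun l' => ?_) (by simp [gradient])
      by_cases he : l' = l
      · subst he
        simp only [gradient, LinearMap.coe_mk, AddHom.coe_mk, Pi.single_eq_same]
        field_simp
        ring
      · have : q (b l') = q (a l') := by
          have := hP l' (Finset.mem_erase.2 ⟨fun h => he (Subtype.ext h), l'.2⟩)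
          simp only [q, this]
        simp [gradient, this, he]
    have hone : ∃ q, gradient a b T v q = (0, 1) :=
      ⟨fun _ => 1, Prod.ext (funext fun l => by simp [gradient]) (by simp [gradient])⟩
    choose q hq using hbasis
    obtain ⟨q0, hq0⟩ := hone
    rintro ⟨x, r⟩ -
    refine ⟨∑ l, x l • q l + r • q0, ?_⟩
    simp only [map_add, map_sum, map_smul, hq, hq0]
    refine Prod.ext (funext fun l => ?_) ?_
    · simp [Prod.fst_sum, Finset.sum_apply, Pi.single_apply]
    · simp [Prod.snd_sum]
  have := (LinearEquiv.ofBijective _ ⟨hinj, hsurj⟩).finrank_eq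
  rw [Module.finrank_prod, Module.finrank_fintype_fun_eq_card, Module.finrank_fintype_fun_eq_card,
    Module.finrank_self, Fintype.card_coe] at this
  rw [Nat.card_eq_fintype_card, this]

/-! ### Cycles of permutations -/

theorem sameCycle_invariant {D : Type*} {π : Equiv.Perm D} {P : D → Prop}
    (hP : ∀ c, P (π c) ↔ P c) {a b : D} (h : π.SameCycle a b) : P a ↔ P b := by
  obtain ⟨i, rfl⟩ := h
  have key : ∀ i : ℕ, ∀ c, P ((π ^ i) c) ↔ P c := by
    intro i
    induction i with
    | zero => simp
    | succ i ih =>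
      intro c
      rw [pow_succ', Equiv.Perm.mul_apply, hP, ih]
  cases i with
  | ofNat i =>
    rw [Int.ofNat_eq_natCast, zpow_natCast, key]
  | negSucc i =>
    rw [zpow_negSucc]
    have := key (i + 1) ((π ^ (i + 1))⁻¹ a)
    rwa [← Equiv.Perm.mul_apply, mul_inv_cancel, Equiv.Perm.one_apply] at this

theorem card_cycles_eq_one_iff {D : Type*} (π : Equiv.Perm D) :
    Nat.card (Quotient (Equiv.Perm.SameCycle.setoid π)) = 1 ↔
      Nonempty D ∧ ∀ a b, π.SameCycle a b := by
  rw [Nat.card_eq_one_iff_unique]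
  constructor
  · rintro ⟨hs, ⟨x⟩⟩
    obtain ⟨c, rfl⟩ := Quotient.exists_rep x
    exact ⟨⟨c⟩, fun a b => Quotient.exact (hs.elim (Quotient.mk _ a) (Quotient.mk _ b))⟩
  · rintro ⟨⟨c⟩, h⟩
    refine ⟨⟨fun x y => ?_⟩, ⟨Quotient.mk _ c⟩⟩
    obtain ⟨a, rfl⟩ := Quotient.exists_rep x
    obtain ⟨b, rfl⟩ := Quotient.exists_rep y
    exact Quotient.sound (h a b)

/-- A return consists of steps of `π`; conversely, a walk from `x` to `y` along `π` cannot reach `y`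
before the first return of `x`, so it can be shortened by that return. -/
theorem sameCycle_returnPerm {D : Type*} [Finite D] (π : Equiv.Perm D) (p : D → Prop)
    (x y : {d // p d}) : (returnPerm π p).SameCycle x y ↔ π.SameCycle x.1 y.1 := by
  constructor
  · intro h
    refine (sameCycle_invariant (π := returnPerm π p) (P := fun z => π.SameCycle x.1 z.1)
      (fun z => ?_) h).1 (Equiv.Perm.SameCycle.refl _ _)
    exact Equiv.Perm.sameCycle_pow_right (n := returnTime π p z)
  · intro h
    obtain ⟨k, hk⟩ : ∃ k : ℕ, (π ^ k) x.1 = y.1 := by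
      obtain ⟨k, -, hk⟩ := h.exists_pow_eq'
      exact ⟨k, hk⟩
    induction k using Nat.strong_induction_on generalizing x with
    | _ k ih =>
      rcases Nat.eq_zero_or_pos k with rfl | hpos
      · have : x = y := Subtype.ext (by simpa using hk)
        rw [this]
      · have hle := returnTime_le π p x hpos (by rw [hk]; exact y.2)
        have hpos' := (returnTime_spec π p x).1
        have h1 : (π ^ (k - returnTime π p x)) (returnPerm π p x).1 = y.1 := by
          show (π ^ (k - returnTime π p x)) ((π ^ returnTime π p x) x.1) = y.1
          rw [← Equiv.Perm.mul_apply, ← pow_add, Nat.sub_add_cancel hle, hk]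
        have h2 : π.SameCycle (returnPerm π p x).1 y.1 := ⟨_, by rw [zpow_natCast]; exact h1⟩
        exact Equiv.Perm.sameCycle_apply_left.1 (ih _ (by omega) _ h2 h1)

/-- Before it returns, the orbit only visits elements outside `p`, so the values of the permutations
on `p` matter only at the starting points. -/
theorem firstReturn_congr {D : Type*} [Finite D] (π π' : Equiv.Perm D) (p : D → Prop)
    (x y : {d // p d}) (hx : π' y.1 = π x.1) (h : ∀ c, ¬ p c → π' c = π c) :
    firstReturn π' p y = firstReturn π p x := by
  have key : ∀ k, (∀ j, 1 ≤ j → j ≤ k → ¬ p ((π ^ j) x.1)) →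
      (π' ^ (k + 1)) y.1 = (π ^ (k + 1)) x.1 := by
    intro k
    induction k with
    | zero => intro _; simpa using hx
    | succ k ih =>
      intro hj
      rw [pow_succ' π', Equiv.Perm.mul_apply, ih fun j h1 h2 => hj j h1 (by omega),
        h _ (hj (k + 1) (by omega) le_rfl), pow_succ' π (k + 1), Equiv.Perm.mul_apply]
  have hmin : ∀ j, 1 ≤ j → j < returnTime π p x → ¬ p ((π ^ j) x.1) := fun j h1 h2 h3 => by
    have := returnTime_le π p x h1 h3
    omega
  have key' : ∀ k, 1 ≤ k → k ≤ returnTime π p x → (π' ^ k) y.1 = (π ^ k) x.1 := by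
    intro k h1 h2
    obtain ⟨k, rfl⟩ := Nat.exists_eq_add_of_le' h1
    exact key k fun j h3 h4 => hmin j h3 (by omega)
  have hx' := returnTime_spec π p x
  have hy' := returnTime_spec π' p y
  have h1 : returnTime π' p y = returnTime π p x := by
    apply le_antisymm
    · exact returnTime_le π' p y hx'.1 (by rw [key' _ hx'.1 le_rfl]; exact hx'.2)
    · by_contra hlt
      push Not at hlt
      refine hmin _ hy'.1 hlt ?_
      rw [← key' _ hy'.1 hlt.le]
      exact hy'.2
  refine Subtype.ext ?_
  show (π' ^ returnTime π' p y) y.1 = (π ^ returnTime π p x) x.1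
  rw [h1, key' _ hx'.1 le_rfl]

/-! ### Faces of ribbon graphs -/

namespace RibbonGraph

variable {D Λ : Type*} (R : RibbonGraph D Λ)

theorem opp_tail (l : Λ) : R.opp (R.tail l) = R.head l := R.oppFun_tail l

theorem opp_head (l : Λ) : R.opp (R.head l) = R.tail l := R.oppFun_head l

theorem opp_external {c : D} (h : ∀ l, R.tail l ≠ c ∧ R.head l ≠ c) : R.opp c = c := by
  show R.oppFun c = c
  rw [oppFun, dif_neg fun ⟨l, hl⟩ => (h l).1 hl, dif_neg fun ⟨l, hl⟩ => (h l).2 hl]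

theorem corner_cases (c : D) :
    (∃ l, R.tail l = c) ∨ (∃ l, R.head l = c) ∨ ∀ l, R.tail l ≠ c ∧ R.head l ≠ c := by
  by_cases h : ∃ l, R.tail l = c
  · exact Or.inl h
  · by_cases h' : ∃ l, R.head l = c
    · exact Or.inr (Or.inl h')
    · exact Or.inr (Or.inr fun l => ⟨fun e => h ⟨l, e⟩, fun e => h' ⟨l, e⟩⟩)

theorem tail_injective : Function.Injective R.tail := fun l l' h =>
  Sum.inl.inj (R.inj (a₁ := Sum.inl l) (a₂ := Sum.inl l') h)

theorem head_injective : Function.Injective R.head := fun l l' h =>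
  Sum.inr.inj (R.inj (a₁ := Sum.inr l) (a₂ := Sum.inr l') h)

theorem tail_ne_head (l l' : Λ) : R.tail l ≠ R.head l' := fun h => by
  cases R.inj (a₁ := Sum.inl l) (a₂ := Sum.inr l') h

theorem opp_opp (c : D) : R.opp (R.opp c) = c := R.oppFun_involutive c

theorem opp_keepLines (p : Λ → Prop) (c : D) :
    ((R.keepLines p).opp c = R.opp c ∧ ∃ l, p l ∧ (R.tail l = c ∨ R.head l = c)) ∨
    ((R.keepLines p).opp c = c ∧ ∀ l, p l → R.tail l ≠ c ∧ R.head l ≠ c) := by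
  rcases (R.keepLines p).corner_cases c with ⟨l, rfl⟩ | ⟨l, rfl⟩ | h
  · left
    rw [opp_tail]
    exact ⟨(R.opp_tail l.1).symm, l.1, l.2, Or.inl rfl⟩
  · left
    rw [opp_head]
    exact ⟨(R.opp_head l.1).symm, l.1, l.2, Or.inr rfl⟩
  · right
    exact ⟨opp_external _ h, fun l hl => h ⟨l, hl⟩⟩

theorem faceOf_eq_iff {a b : D} : R.faceOf a = R.faceOf b ↔ R.faceNext.SameCycle a b :=
  Quotient.eq

theorem faceOf_surjective : Function.Surjective R.faceOf := Quotient.mk_surjective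

theorem faceOf_next (c : D) : R.faceOf (R.next c) = R.faceOf (R.opp c) := by
  rw [eq_comm, faceOf_eq_iff]
  have h : R.next c = R.faceNext (R.opp c) := by
    rw [faceNext, Equiv.Perm.mul_apply, opp_opp]
  rw [h, Equiv.Perm.sameCycle_apply_right]

instance [Finite D] : Finite R.Face := Quotient.finite _

instance [Nonempty D] : Nonempty R.Face := ‹Nonempty D›.map R.faceOf

/-- The dual ribbon graph, whose vertices are the faces. -/
def dual : RibbonGraph D Λ where
  next := R.faceNext
  tail := R.tail
  head := R.head
  inj := R.inj

/-- Duality exchanges keeping and deleting lines: crossing the lines of `J` and then all lines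
amounts to crossing the lines outside `J`. Statements about trees of the dual graph thereby become
statements about deletion. -/
theorem faceNext_dual_keepLines (J : Finset Λ) :
    (R.dual.keepLines (fun l => l ∈ J)).faceNext = (R.deleteLines J).faceNext := by
  ext c
  show R.next (R.opp ((R.dual.keepLines fun l => l ∈ J).opp c)) =
    R.next ((R.keepLines fun l => l ∉ J).opp c)
  congr 1
  rcases R.opp_keepLines (fun l => l ∉ J) c with ⟨h1, l, hl, h2⟩ | ⟨h1, h2⟩ <;>
  rcases R.dual.opp_keepLines (fun l => l ∈ J) c with ⟨h3, l', hl', h4⟩ | ⟨h3, h4⟩ <;> rw [h1, h3]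
  · exfalso
    change R.tail l' = c ∨ R.head l' = c at h4
    rcases h2 with rfl | rfl <;> rcases h4 with h4 | h4
    · exact hl (R.tail_injective h4 ▸ hl')
    · exact R.tail_ne_head _ _ h4.symm
    · exact R.tail_ne_head _ _ h4
    · exact hl (R.head_injective h4 ▸ hl')
  · change R.opp (R.oppFun c) = c
    exact R.opp_opp c
  · refine R.opp_external fun l => ?_
    by_cases hl : l ∈ J
    · exact h4 l hl
    · exact h2 l hl

/-- Contraction only skips corners in the tour of the faces: at a corner of `T` the two walks agree,
and at a surviving corner the new involution is the old one. -/
theorem contractLines_faceNext [Finite D] (T : Finset Λ) :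
    (R.contractLines T).faceNext = returnPerm R.faceNext (R.Avoids T) := by
  refine Equiv.ext fun x => ?_
  show firstReturn (R.next * (R.keepLines (fun l => l ∈ T)).opp) (R.Avoids T)
    ((R.contractLines T).opp x) = firstReturn R.faceNext (R.Avoids T) x
  have hopp : ((R.contractLines T).opp x).1 = R.opp x.1 := by
    rcases (R.contractLines T).corner_cases x with ⟨l, rfl⟩ | ⟨l, rfl⟩ | hc
    · rw [opp_tail]
      exact (R.opp_tail l.1).symm
    · rw [opp_head]
      exact (R.opp_head l.1).symm
    · rw [opp_external _ hc, opp_external]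
      intro l
      by_cases hl : l ∈ T
      · exact x.2 l hl
      · exact ⟨fun h => (hc ⟨l, hl⟩).1 (Subtype.ext h), fun h => (hc ⟨l, hl⟩).2 (Subtype.ext h)⟩
  apply firstReturn_congr
  · show R.next ((R.keepLines (fun l => l ∈ T)).opp ((R.contractLines T).opp x).1) =
      R.next (R.opp x.1)
    congr 1
    rw [← hopp]
    exact opp_external _ fun l => ((R.contractLines T).opp x).2 l.1 l.2
  · intro c hc
    show R.next ((R.keepLines (fun l => l ∈ T)).opp c) = R.next (R.opp c)
    congr 1
    rcases R.opp_keepLines (fun l => l ∈ T) c with ⟨h1, -⟩ | ⟨h1, h2⟩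
    · exact h1
    · exact absurd h2 hc

/-- If the graph without the lines of `J` has one face, then `J` connects the dual graph. -/
theorem connects_dual_of_sameCycle {J : Finset Λ}
    (h : ∀ a b, (R.deleteLines J).faceNext.SameCycle a b) :
    Connects (fun l => R.faceOf (R.tail l)) (fun l => R.faceOf (R.head l)) J := by
  intro P hP x y hx
  obtain ⟨a, rfl⟩ := R.faceOf_surjective x
  obtain ⟨b, rfl⟩ := R.faceOf_surjective y
  refine (sameCycle_invariant (P := fun c => P (R.faceOf c)) (fun c => ?_) (h a b)).1 hx
  show P (R.faceOf (R.next ((R.keepLines fun l => l ∉ J).opp c))) ↔ _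
  rw [faceOf_next]
  rcases R.opp_keepLines (fun l => l ∉ J) c with ⟨h1, -⟩ | ⟨h1, h2⟩
  · rw [h1, opp_opp]
  · rw [h1]
    rcases R.corner_cases c with ⟨l, rfl⟩ | ⟨l, rfl⟩ | hc
    · rw [opp_tail]
      exact (hP l (by by_contra h; exact (h2 l h).1 rfl)).symm
    · rw [opp_head]
      exact hP l (by by_contra h; exact (h2 l h).2 rfl)
    · rw [opp_external _ hc]

/-! ### Euler's inequality, trees and contractions -/

variable [Fintype Λ]

theorem sum_corners [Fintype D] {M : Type*} [AddCommMonoid M] (φ : D → M)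
    (h : ∀ c, (∀ l, R.tail l ≠ c ∧ R.head l ≠ c) → φ c = 0) :
    ∑ c, φ c = ∑ l, (φ (R.tail l) + φ (R.head l)) := by
  rw [Finset.sum_add_distrib]
  rw [show ∑ l, φ (R.tail l) + ∑ l, φ (R.head l) = ∑ x, φ (Sum.elim R.tail R.head x) by
    rw [Fintype.sum_sum_type]; rfl]
  symm
  refine Finset.sum_of_injOn (Sum.elim R.tail R.head) R.inj.injOn (by simp) ?_ (by simp)
  intro c _ hc
  refine h c fun l => ⟨fun h => hc ?_, fun h => hc ?_⟩
  · exact ⟨Sum.inl l, by simp, h⟩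
  · exact ⟨Sum.inr l, by simp, h⟩

/-- The differences of a function of the faces and of a function of the vertices along the lines
are orthogonal. -/
theorem sum_mul_eq_zero [Fintype D] {V K : Type*} [CommRing K] (vert : D → V)
    (hv : ∀ c, vert (R.next c) = vert c) (f : R.Face → K) (q : V → K) :
    ∑ l, (f (R.faceOf (R.head l)) - f (R.faceOf (R.tail l))) *
      (q (vert (R.head l)) - q (vert (R.tail l))) = 0 := by
  -- The sum vanishes because `q ∘ vert` is invariant under `next`; grouping the corners by lines
  -- then gives the required identity.
  have h1 : ∑ c, (f (R.faceOf c) - f (R.faceOf (R.next c))) * q (vert c) = 0 := by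
    simp only [sub_mul, Finset.sum_sub_distrib]
    rw [sub_eq_zero, ← Equiv.sum_comp R.next (fun c => f (R.faceOf c) * q (vert c))]
    simp only [hv]
  rw [← h1, R.sum_corners]
  · refine Finset.sum_congr rfl fun l _ => ?_
    rw [faceOf_next, faceOf_next, opp_head, opp_tail]
    ring
  · intro c hc
    rw [faceOf_next, opp_external _ hc, sub_self, zero_mul]

/-- Euler's inequality. -/
theorem card_face_add_card_vertex_le [Finite D] [Nonempty D] {V : Type*} [Finite V] (vert : D → V)
    (hv : ∀ c, vert (R.next c) = vert c)
    (hv' : ∀ a b, vert a = vert b → R.next.SameCycle a b)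
    (hconn : Connects (fun l => vert (R.tail l)) (fun l => vert (R.head l)) Finset.univ) :
    Nat.card R.Face + Nat.card V ≤ Fintype.card Λ + 2 := by
  have := Fintype.ofFinite D
  have := Fintype.ofFinite V
  have := Fintype.ofFinite R.Face
  obtain ⟨c₀⟩ := ‹Nonempty D›
  -- The two values at `c₀` remove the constants, so injectivity yields `F + n ≤ L + 2`.
  let Φ : ((R.Face → ℚ) × (V → ℚ)) →ₗ[ℚ] (Λ → ℚ) × ℚ × ℚ :=
    { toFun := fun p => (fun l => (p.1 (R.faceOf (R.head l)) - p.1 (R.faceOf (R.tail l))) +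
          (p.2 (vert (R.head l)) - p.2 (vert (R.tail l))), p.1 (R.faceOf c₀), p.2 (vert c₀))
      map_add' := fun p p' => by
        refine Prod.ext (funext fun l => ?_) rfl
        simp only [Prod.fst_add, Prod.snd_add, Pi.add_apply]
        ring
      map_smul' := fun r p => by
        refine Prod.ext (funext fun l => ?_) rfl
        simp only [Prod.smul_fst, Prod.smul_snd, Pi.smul_apply, smul_eq_mul, RingHom.id_apply]
        ring }
  have hinj : Function.Injective Φ := by
    rw [← LinearMap.ker_eq_bot, LinearMap.ker_eq_bot']
    rintro ⟨f, q⟩ h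
    have h1 : ∀ l, (f (R.faceOf (R.head l)) - f (R.faceOf (R.tail l))) +
        (q (vert (R.head l)) - q (vert (R.tail l))) = 0 :=
      fun l => congrFun (congrArg Prod.fst h) l
    have h2 : f (R.faceOf c₀) = 0 := congrArg (fun p => p.2.1) h
    have h3 : q (vert c₀) = 0 := congrArg (fun p => p.2.2) h
    -- In the kernel the two differences are opposite as well as orthogonal, so over `ℚ` both
    -- vanish.
    have h4 : ∑ l, (f (R.faceOf (R.head l)) - f (R.faceOf (R.tail l))) ^ 2 = 0 := by
      have := R.sum_mul_eq_zero vert hv f q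
      rw [← neg_eq_zero, ← Finset.sum_neg_distrib] at this
      rw [← this]
      refine Finset.sum_congr rfl fun l _ => ?_
      linear_combination (f (R.faceOf (R.head l)) - f (R.faceOf (R.tail l))) * h1 l
    have h5 : ∀ l, f (R.faceOf (R.head l)) = f (R.faceOf (R.tail l)) := by
      intro l
      rw [Finset.sum_eq_zero_iff_of_nonneg fun _ _ => sq_nonneg _] at h4
      exact sub_eq_zero.1 (pow_eq_zero_iff two_ne_zero |>.1 (h4 l (Finset.mem_univ _)))
    have h6 : ∀ l, q (vert (R.head l)) = q (vert (R.tail l)) := by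
      intro l
      have := h1 l
      rw [h5 l, sub_self, zero_add] at this
      exact sub_eq_zero.1 this
    have h7 : ∀ c, f (R.faceOf (R.next c)) = f (R.faceOf c) := by
      intro c
      rw [faceOf_next]
      rcases R.corner_cases c with ⟨l, rfl⟩ | ⟨l, rfl⟩ | hc
      · rw [opp_tail, h5]
      · rw [opp_head, h5]
      · rw [opp_external _ hc]
    have h8 : ∀ a b, vert a = vert b → f (R.faceOf a) = 0 → f (R.faceOf b) = 0 := by
      intro a b hab
      exact (sameCycle_invariant (P := fun c => f (R.faceOf c) = 0)
        (fun c => by rw [h7]) (hv' a b hab)).1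
    have hf : ∀ v, ∀ c, vert c = v → f (R.faceOf c) = 0 := by
      intro v
      refine hconn (fun v => ∀ c, vert c = v → f (R.faceOf c) = 0) (fun l _ => ?_) (vert c₀) v
        fun c hc => h8 _ _ hc.symm h2
      constructor
      · intro h c hc
        exact h8 _ _ hc.symm (by rw [h5]; exact h _ rfl)
      · intro h c hc
        exact h8 _ _ hc.symm (by rw [← h5]; exact h _ rfl)
    have hq : ∀ v, q v = 0 := fun v =>
      hconn (fun v => q v = 0) (fun l _ => by simp only [h6]) (vert c₀) v h3
    refine Prod.ext (funext fun x => ?_) (funext hq)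
    obtain ⟨c, rfl⟩ := R.faceOf_surjective x
    exact hf _ c rfl
  have := LinearMap.finrank_le_finrank_of_injective hinj
  simp only [Module.finrank_prod, Module.finrank_fintype_fun_eq_card, Module.finrank_self] at this
  rw [Nat.card_eq_fintype_card, Nat.card_eq_fintype_card]
  omega

/-- A spanning tree, drawn on a surface, has only one face. -/
theorem sameCycle_keepLines_of_isSpanningTree {Λ : Type*} (R : RibbonGraph D Λ) [Finite D] {V : Type*} [Finite V] (vert : D → V)
    (hv : ∀ c, vert (R.next c) = vert c)
    (hv' : ∀ a b, vert a = vert b → R.next.SameCycle a b) {T : Finset Λ}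
    (hT : IsSpanningTree (fun l => vert (R.tail l)) (fun l => vert (R.head l)) T) (a b : D) :
    (R.keepLines (fun l => l ∈ T)).faceNext.SameCycle a b := by
  have : Nonempty D := ⟨a⟩
  rw [isSpanningTree_iff] at hT
  -- With `L = n - 1`, Euler's inequality reads `F ≤ 1`.
  have h := (R.keepLines (fun l => l ∈ T)).card_face_add_card_vertex_le vert hv hv'
    (fun P hP => hT.1 P fun l hl => hP ⟨l, hl⟩ (Finset.mem_univ _))
  rw [Fintype.card_coe] at h
  have h1 : Nat.card (R.keepLines (fun l => l ∈ T)).Face ≤ 1 := by omega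
  have := Finite.card_le_one_iff_subsingleton.1 h1
  exact (faceOf_eq_iff _).1 (Subsingleton.elim _ _)

theorem sameCycle_deleteLines_of_isDualTree {Λ : Type*} (R : RibbonGraph D Λ) [Finite D] {J : Finset Λ} (hJ : R.IsDualTree J)
    (a b : D) : (R.deleteLines J).faceNext.SameCycle a b := by
  rw [← faceNext_dual_keepLines]
  exact R.dual.sameCycle_keepLines_of_isSpanningTree R.faceOf
    (fun c => R.faceOf_eq_iff.2 (Equiv.Perm.sameCycle_apply_left.2 (Equiv.Perm.SameCycle.refl _ _)))
    (fun a b h => R.faceOf_eq_iff.1 h) hJ a b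

/-- The dual of a connected graph is connected. -/
theorem connects_dual {V : Type*} (vert : D → V)
    (hv' : ∀ a b, vert a = vert b → R.next.SameCycle a b)
    (hconn : Connects (fun l => vert (R.tail l)) (fun l => vert (R.head l)) Finset.univ) :
    Connects (fun l => R.faceOf (R.tail l)) (fun l => R.faceOf (R.head l)) Finset.univ := by
  intro P hP x y hx
  obtain ⟨a, rfl⟩ := R.faceOf_surjective x
  obtain ⟨b, rfl⟩ := R.faceOf_surjective y
  have h1 : ∀ c, P (R.faceOf (R.next c)) ↔ P (R.faceOf c) := by
    intro c
    rw [faceOf_next]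
    rcases R.corner_cases c with ⟨l, rfl⟩ | ⟨l, rfl⟩ | hc
    · rw [opp_tail]
      exact (hP l (Finset.mem_univ _)).symm
    · rw [opp_head]
      exact hP l (Finset.mem_univ _)
    · rw [opp_external _ hc]
  have h2 : ∀ c d, vert c = vert d → P (R.faceOf c) → P (R.faceOf d) := fun c d h =>
    (sameCycle_invariant (P := fun c => P (R.faceOf c)) h1 (hv' c d h)).1
  refine hconn (fun v => ∀ c, vert c = v → P (R.faceOf c)) (fun l hl => ?_) (vert a) (vert b)
    (fun c hc => h2 _ _ hc.symm hx) b rfl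
  constructor
  · intro h c hc
    exact h2 _ _ hc.symm ((hP l hl).1 (h _ rfl))
  · intro h c hc
    exact h2 _ _ hc.symm ((hP l hl).2 (h _ rfl))

/-- If there is only one face, then the graph is connected. -/
theorem connects_of_sameCycle {V : Type*} (vert : D → V) (hs : Function.Surjective vert)
    (hv : ∀ c, vert (R.next c) = vert c) (h : ∀ a b, R.faceNext.SameCycle a b) :
    Connects (fun l => vert (R.tail l)) (fun l => vert (R.head l)) Finset.univ := by
  intro P hP x y hx
  obtain ⟨a, rfl⟩ := hs x
  obtain ⟨b, rfl⟩ := hs y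
  refine (sameCycle_invariant (P := fun c => P (vert c)) (fun c => ?_) (h a b)).1 hx
  show P (vert (R.next (R.opp c))) ↔ _
  rw [hv]
  rcases R.corner_cases c with ⟨l, rfl⟩ | ⟨l, rfl⟩ | hc
  · rw [opp_tail]
    exact (hP l (Finset.mem_univ _)).symm
  · rw [opp_head]
    exact hP l (Finset.mem_univ _)
  · rw [opp_external _ hc]

/-- The contraction of a tree yields a superrosette if and only if there is only one face. -/
theorem isSuperrosette_contractLines_iff {Λ : Type*} (R : RibbonGraph D Λ) [Finite D] {V : Type*} [Finite V] (vert : D → V)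
    (hv : ∀ c, vert (R.next c) = vert c)
    (hv' : ∀ a b, vert a = vert b → R.next.SameCycle a b) {T : Finset Λ}
    (hT : IsSpanningTree (fun l => vert (R.tail l)) (fun l => vert (R.head l)) T)
    (hne : ∃ c, R.Avoids T c) :
    (R.contractLines T).IsSuperrosette ↔ ∀ a b, R.faceNext.SameCycle a b := by
  obtain ⟨c₀, hc₀⟩ := hne
  have htree := R.sameCycle_keepLines_of_isSpanningTree vert hv hv' hT
  -- The vertices of the contraction are the traces of the faces of the tree `T`, of which there is
  -- only one.
  have hV : Nat.card (R.contractLines T).Vertex = 1 := by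
    refine (card_cycles_eq_one_iff _).2 ⟨⟨⟨c₀, hc₀⟩⟩, fun a b => ?_⟩
    exact (sameCycle_returnPerm _ _ _ _).2 (htree a.1 b.1)
  have hF : Nat.card (R.contractLines T).Face = 1 ↔ _ := card_cycles_eq_one_iff _
  rw [IsSuperrosette, hF, contractLines_faceNext]
  simp only [sameCycle_returnPerm]
  constructor
  · rintro ⟨-, -, h⟩
    -- Every face contains a surviving corner. Otherwise it would be stable under the face walk of
    -- the tree, which agrees with `faceNext` at the corners of `T` and sends a surviving `c` to the
    -- successor of the surviving `opp c`. This walk has one cycle, so it would reach `c₀`.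
    have key : ∀ a, ∃ a' : {c // R.Avoids T c}, R.faceNext.SameCycle a a'.1 := by
      intro a
      by_contra hn
      push Not at hn
      have hn' : ∀ c, R.faceNext.SameCycle a c → ¬ R.Avoids T c := fun c hc h => hn ⟨c, h⟩ hc
      refine hn' c₀ ?_ hc₀
      refine (sameCycle_invariant (P := fun c => R.faceNext.SameCycle a c) (fun c => ?_)
        (htree a c₀)).1 (Equiv.Perm.SameCycle.refl _ _)
      by_cases hc : R.Avoids T c
      · have hopp : R.Avoids T (R.opp c) := by
          refine fun l hl => ⟨fun h => (hc l hl).2 ?_, fun h => (hc l hl).1 ?_⟩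
          · rw [← R.opp_tail, h, opp_opp]
          · rw [← R.opp_head, h, opp_opp]
        have h1 : (R.keepLines fun l => l ∈ T).faceNext c = R.faceNext (R.opp c) := by
          show R.next ((R.keepLines fun l => l ∈ T).opp c) = R.next (R.opp (R.opp c))
          rw [opp_opp, opp_external _ fun l => hc l.1 l.2]
        rw [h1, Equiv.Perm.sameCycle_apply_right]
        exact ⟨fun h => absurd hopp (hn' _ h), fun h => absurd hc (hn' _ h)⟩
      · have h1 : (R.keepLines fun l => l ∈ T).faceNext c = R.faceNext c := by
          show R.next ((R.keepLines fun l => l ∈ T).opp c) = R.next (R.opp c)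
          rcases R.opp_keepLines (fun l => l ∈ T) c with ⟨h1, -⟩ | ⟨h1, h2⟩
          · rw [h1]
          · exact absurd h2 hc
        rw [h1, Equiv.Perm.sameCycle_apply_right]
    intro a b
    obtain ⟨a', ha⟩ := key a
    obtain ⟨b', hb⟩ := key b
    exact ha.trans ((h a' b').trans hb.symm)
  · intro h
    exact ⟨hV, ⟨⟨c₀, hc₀⟩⟩, fun a b => h a.1 b.1⟩

end RibbonGraph

namespace FeynmanGraph

variable {V Λ : Type*} (G : FeynmanGraph V Λ)

/-! ### Admissible sets of lines -/

/-- Remove the lines of `J`. -/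
def deleteLines (J : Finset Λ) : FeynmanGraph V {l // l ∉ J} where
  deg := G.deg
  deg_pos := G.deg_pos
  tail l := G.tail l.1
  head l := G.head l.1
  inj := (G.ribbon.deleteLines J).inj

theorem Orientable.deleteLines {G : FeynmanGraph V Λ} (hG : G.Orientable) (J : Finset Λ) :
    (G.deleteLines J).Orientable := by
  obtain ⟨χ, h1, h2⟩ := hG
  exact ⟨χ, h1, fun l => h2 l.1⟩

theorem connected_iff : G.Connected ↔
    ∀ P : V → Prop, (∀ l, P (G.tail l).1 ↔ P (G.head l).1) → ∀ x y, P x → P y := by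
  rw [Connected, eqvGen_forall_iff]
  refine forall_congr' fun P => imp_congr_left ?_
  exact ⟨fun h l => h _ _ ⟨l, rfl, rfl⟩, by rintro h _ _ ⟨l, rfl, rfl⟩; exact h l⟩

theorem connected_iff_connects [Fintype Λ] : G.Connected ↔
    Connects (fun l => (G.tail l).1) (fun l => (G.head l).1) Finset.univ := by
  simp only [connected_iff, Connects, Finset.mem_univ, true_imp_iff]

theorem next_mk_of_lt (v : V) (i : ℕ) (h : i + 1 < G.deg v) :
    G.next ⟨v, ⟨i, by omega⟩⟩ = ⟨v, ⟨i + 1, h⟩⟩ := by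
  have key : ∀ (d : ℕ) (h : i + 1 < d), finRotate d ⟨i, by omega⟩ = ⟨i + 1, h⟩ := by
    intro d h
    cases d with
    | zero => omega
    | succ d => exact finRotate_of_lt (by omega)
  exact congrArg (Sigma.mk v) (key _ h)

theorem next_mk_last (v : V) (i : ℕ) (h : i + 1 = G.deg v) :
    G.next ⟨v, ⟨i, by omega⟩⟩ = ⟨v, ⟨0, by omega⟩⟩ := by
  have key : ∀ (d : ℕ) (h : i + 1 = d), finRotate d ⟨i, by omega⟩ = ⟨0, by omega⟩ := by
    rintro d rfl
    exact finRotate_last'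
  exact congrArg (Sigma.mk v) (key _ h)

theorem sameCycle_next_of_fst_eq (a b : G.Corner) (h : a.1 = b.1) : G.next.SameCycle a b := by
  have key : ∀ v i (hi : i < G.deg v), G.next.SameCycle ⟨v, ⟨0, G.deg_pos v⟩⟩ ⟨v, ⟨i, hi⟩⟩ := by
    intro v i
    induction i with
    | zero => intro _; exact Equiv.Perm.SameCycle.refl _ _
    | succ i ih =>
      intro hi
      rw [← G.next_mk_of_lt v i hi, Equiv.Perm.sameCycle_apply_right]
      exact ih _
  obtain ⟨v, i⟩ := a
  obtain ⟨w, j⟩ := b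
  obtain rfl : v = w := h
  exact (key v i i.2).symm.trans (key v j j.2)

theorem fst_surjective : Function.Surjective (fun c : G.Corner => c.1) :=
  fun v => ⟨⟨v, ⟨0, G.deg_pos v⟩⟩, rfl⟩

instance [Nonempty V] : Nonempty G.Corner :=
  let ⟨v⟩ := ‹Nonempty V›
  ⟨⟨v, ⟨0, G.deg_pos v⟩⟩⟩

/-- At a vertex with a single corner, `next` fixes that corner, whose sign would be its own
opposite. The bound guarantees that some corner survives the contraction of a tree. -/
theorem Orientable.two_le_deg {G : FeynmanGraph V Λ} (hG : G.Orientable) (v : V) :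
    2 ≤ G.deg v := by
  by_contra h
  have h1 : 0 + 1 = G.deg v := by
    have := G.deg_pos v
    omega
  obtain ⟨χ, hχ, -⟩ := hG
  have := hχ ⟨v, ⟨0, G.deg_pos v⟩⟩
  rw [G.next_mk_last v 0 h1] at this
  have h2 := congrArg (Units.val) this
  rw [Units.val_neg] at h2
  have h3 := (χ ⟨v, ⟨0, G.deg_pos v⟩⟩).ne_zero
  omega

theorem exists_avoids [Fintype V] (hdeg : ∀ v, 2 ≤ G.deg v) {T : Finset Λ}
    (hT : T.card + 1 = Nat.card V) : ∃ c, G.ribbon.Avoids T c := by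
  by_contra hn
  have hs : ∀ c, ∃ x : T ⊕ T, Sum.elim (fun l : T => G.tail l) (fun l : T => G.head l) x = c := by
    intro c
    by_contra hc
    refine hn ⟨c, fun l hl => ⟨fun h => hc ⟨Sum.inl ⟨l, hl⟩, h⟩, fun h => hc ⟨Sum.inr ⟨l, hl⟩, h⟩⟩⟩
  have h1 := Fintype.card_le_of_surjective _ hs
  rw [Fintype.card_sigma, Fintype.card_sum, Fintype.card_coe] at h1
  simp only [Fintype.card_fin] at h1
  have h2 : ∑ _v : V, 2 ≤ ∑ v, G.deg v := Finset.sum_le_sum fun v _ => hdeg v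
  rw [Finset.sum_const, Finset.card_univ, smul_eq_mul] at h2
  rw [Nat.card_eq_fintype_card] at hT
  omega

theorem isTree_map_iff {J : Finset Λ} (T : Finset {l // l ∉ J}) :
    G.IsTree (T.map (Function.Embedding.subtype _)) ↔ (G.deleteLines J).IsTree T := by
  simp only [IsTree, isSpanningTree_iff, Connects, Finset.mem_map, Finset.card_map,
    Function.Embedding.coe_subtype, forall_exists_index, and_imp, forall_apply_eq_imp_iff₂]
  rfl

/-- Contracting a spanning tree preserves having one face, so the superrosette condition is a
condition on the graph without `J`. Conversely, a single face makes `J` connect the dual graph and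
the other lines connect the graph, and both required trees can be extracted. -/
theorem admissible_iff [Fintype V] [Nonempty V] [Fintype Λ] (hG : G.Orientable) (J : Finset Λ) :
    G.Admissible J ↔ ∀ a b, (G.deleteLines J).ribbon.faceNext.SameCycle a b := by
  classical
  have key : ∀ T, (G.deleteLines J).IsTree T →
      (((G.ribbon.deleteLines J).contractLines T).IsSuperrosette ↔
        ∀ a b, (G.deleteLines J).ribbon.faceNext.SameCycle a b) := fun T hT =>
    (G.deleteLines J).ribbon.isSuperrosette_contractLines_iff (fun c => c.1) (fun _ => rfl)
      (G.deleteLines J).sameCycle_next_of_fst_eq hT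
      ((G.deleteLines J).exists_avoids hG.two_le_deg hT.2)
  constructor
  · rintro ⟨-, T, hT, hs⟩
    exact (key T ((G.isTree_map_iff T).1 hT)).1 hs
  · intro h
    refine ⟨(G.ribbon.connects_dual_of_sameCycle h).exists_isSpanningTree, ?_⟩
    have hc := (G.deleteLines J).ribbon.connects_of_sameCycle (fun c => c.1) G.fst_surjective
      (fun _ => rfl) h
    obtain ⟨T, -, hT⟩ := hc.exists_isSpanningTree
    exact ⟨T, (G.isTree_map_iff T).2 hT, (key T hT).2 h⟩

theorem numFaces_eq_one_iff [Nonempty V] :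
    G.numFaces = 1 ↔ ∀ a b, G.ribbon.faceNext.SameCycle a b := by
  have h : G.numFaces = 1 ↔ _ := card_cycles_eq_one_iff G.ribbon.faceNext
  rw [h]
  exact and_iff_right inferInstance

theorem numFaces_pos [Finite V] [Nonempty V] : 0 < G.numFaces := by
  exact Nat.card_pos

theorem connected_of_numFaces_eq_one [Fintype Λ] [Nonempty V] (h : G.numFaces = 1) :
    G.Connected :=
  G.connected_iff_connects.2 (G.ribbon.connects_of_sameCycle (fun c => c.1) G.fst_surjective
    (fun _ => rfl) (G.numFaces_eq_one_iff.1 h))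

theorem Connected.card_le {G : FeynmanGraph V Λ} [Fintype V] [Nonempty V] [Fintype Λ]
    (hG : G.Connected) :
    G.numFaces + Fintype.card V ≤ Fintype.card Λ + 2 := by
  rw [← Nat.card_eq_fintype_card (α := V)]
  exact G.ribbon.card_face_add_card_vertex_le (fun c => c.1) (fun _ => rfl)
    G.sameCycle_next_of_fst_eq (G.connected_iff_connects.1 hG)

theorem Connected.exists_isDualTree {G : FeynmanGraph V Λ} [Fintype V] [Nonempty V] [Fintype Λ]
    (hG : G.Connected) : ∃ J, G.ribbon.IsDualTree J := by
  obtain ⟨T, -, hT⟩ := (G.ribbon.connects_dual (fun c => c.1) G.sameCycle_next_of_fst_eq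
    (G.connected_iff_connects.1 hG)).exists_isSpanningTree
  exact ⟨T, hT⟩

theorem isDualTree_card {J : Finset Λ} (h : G.ribbon.IsDualTree J) : J.card + 1 = G.numFaces :=
  h.2

theorem numFaces_deleteLines_of_isDualTree [Finite V] [Nonempty V] {J : Finset Λ}
    (h : G.ribbon.IsDualTree J) : (G.deleteLines J).numFaces = 1 :=
  (G.deleteLines J).numFaces_eq_one_iff.2 (G.ribbon.sameCycle_deleteLines_of_isDualTree h)

theorem Admissible.numFaces_le {G : FeynmanGraph V Λ} [Finite V]
    {J : Finset Λ} (h : G.Admissible J) : G.numFaces ≤ J.card + 1 := by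
  obtain ⟨⟨S, hS, hT⟩, -⟩ := h
  have h1 := G.isDualTree_card hT
  have h2 := Finset.card_le_card hS
  omega

end FeynmanGraph

namespace FeynmanGraph

variable {V Λ : Type*} (G : FeynmanGraph V Λ)

/-! ### Flows along the lines -/

section Flow

variable [DecidableEq V] [DecidableEq Λ]

theorem tail_injective : Function.Injective G.tail := G.ribbon.tail_injective

theorem head_injective : Function.Injective G.head := G.ribbon.head_injective

theorem head_ne_tail (l l' : Λ) : G.head l ≠ G.tail l' := (G.ribbon.tail_ne_head l' l).symm

theorem eps_head (l l' : Λ) : G.eps l (G.head l') = if l = l' then 1 else 0 := by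
  simp only [eps, G.head_injective.eq_iff, (G.head_ne_tail l' l).symm, if_false]

theorem eps_tail (l l' : Λ) : G.eps l (G.tail l') = if l = l' then -1 else 0 := by
  simp only [eps, G.tail_injective.eq_iff, G.head_ne_tail l l', if_false]

variable [Fintype V] [Fintype Λ] {K : Type*} [CommRing K]

theorem sum_eps_mul (l : Λ) (φ : G.Corner → K) :
    ∑ c, (G.eps l c : K) * φ c = φ (G.head l) - φ (G.tail l) := by
  have h : ∀ c, (G.eps l c : K) * φ c =
      (if G.head l = c then φ c else 0) - if G.tail l = c then φ c else 0 := by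
    intro c
    unfold eps
    split_ifs with h1 h2
    · exact absurd (h1.trans h2.symm) (G.head_ne_tail _ _)
    · simp
    · simp
    · simp
  simp only [h, Finset.sum_sub_distrib, Finset.sum_ite_eq, Finset.mem_univ, if_true]

/-- The function on the corners given by the flow `x` along the lines. -/
def flow (x : Λ → K) (c : G.Corner) : K := ∑ l, (G.eps l c : K) * x l

theorem flow_head (x : Λ → K) (l : Λ) : G.flow x (G.head l) = x l := by
  simp [flow, eps_head]

theorem flow_tail (x : Λ → K) (l : Λ) : G.flow x (G.tail l) = -x l := by
  simp [flow, eps_tail, apply_ite (Int.cast : ℤ → K)]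

theorem flow_external (x : Λ → K) {c : G.Corner} (hc : ∀ l, G.tail l ≠ c ∧ G.head l ≠ c) :
    G.flow x c = 0 := by
  simp [flow, eps, (hc _).1, (hc _).2]

theorem sum_flow (x : Λ → K) : ∑ c, G.flow x c = 0 := by
  simp only [flow]
  rw [Finset.sum_comm]
  refine Finset.sum_eq_zero fun l _ => ?_
  rw [G.sum_eps_mul l fun _ => x l, sub_self]

/-- The sum of `f` over the corners of the vertex `v`. -/
def total (f : G.Corner → K) (v : V) : K := ∑ i : Fin (G.deg v), f ⟨v, i⟩

/-- The sum of `f` over the corners of the same vertex, starting at the corner `c`. -/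
def tailSum (f : G.Corner → K) (c : G.Corner) : K :=
  ∑ j : Fin (G.deg c.1), if c.2 ≤ j then f ⟨c.1, j⟩ else 0

/-- Turns `ω` into a discrete primitive: `ω(i,j)` is twice the indicator of `i ≤ j`, minus that of
`i = j`, minus 1. -/
theorem sum_omega (f : G.Corner → K) (v : V) (i : Fin (G.deg v)) :
    ∑ j, (omega i j : K) * f ⟨v, j⟩ = 2 * G.tailSum f ⟨v, i⟩ - f ⟨v, i⟩ - G.total f v := by
  have h : ∀ j, (omega i j : K) * f ⟨v, j⟩ = 2 * (if i ≤ j then f ⟨v, j⟩ else 0) -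
      (if i = j then f ⟨v, j⟩ else 0) - f ⟨v, j⟩ := by
    intro j
    unfold omega
    rcases lt_trichotomy i j with h | h | h
    · simp [h, h.le, h.ne]; ring
    · simp [h]; ring
    · simp [h, h.not_ge, h.ne', h.not_gt]
  simp only [h, Finset.sum_sub_distrib, ← Finset.mul_sum, Finset.sum_ite_eq, Finset.mem_univ,
    if_true, tailSum, total]

theorem tailSum_zero (f : G.Corner → K) (v : V) :
    G.tailSum f ⟨v, ⟨0, G.deg_pos v⟩⟩ = G.total f v := by
  refine Finset.sum_congr rfl fun j _ => ?_
  rw [if_pos]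
  exact Nat.zero_le _

/-- The vanishing of the totals makes the primitive periodic: it is what the formula needs at the
last corner, where the numbering wraps around. -/
theorem tailSum_next {f : G.Corner → K} (hf : ∀ v, G.total f v = 0) (c : G.Corner) :
    G.tailSum f (G.next c) = G.tailSum f c - f c := by
  obtain ⟨v, i, hi⟩ := c
  have key : ∀ j : Fin (G.deg v), (if (⟨i, hi⟩ : Fin (G.deg v)) ≤ j then f ⟨v, j⟩ else 0) =
      (if i + 1 ≤ (j : ℕ) then f ⟨v, j⟩ else 0) +
        if (⟨i, hi⟩ : Fin (G.deg v)) = j then f ⟨v, j⟩ else 0 := by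
    intro j
    simp only [Fin.le_def, Fin.ext_iff]
    split_ifs <;> first | omega | simp
  have h : G.tailSum f ⟨v, ⟨i, hi⟩⟩ =
      (∑ j : Fin (G.deg v), if i + 1 ≤ (j : ℕ) then f ⟨v, j⟩ else 0) + f ⟨v, ⟨i, hi⟩⟩ := by
    simp only [tailSum, key, Finset.sum_add_distrib, Finset.sum_ite_eq, Finset.mem_univ, if_true]
  rw [h, add_sub_cancel_right]
  rcases Nat.lt_or_ge (i + 1) (G.deg v) with h1 | h1
  · rw [G.next_mk_of_lt v i h1]
    rfl
  · rw [G.next_mk_last v i (by omega), tailSum_zero, hf]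
    symm
    refine Finset.sum_eq_zero fun j _ => if_neg ?_
    have := j.2
    omega

/-! ### The oriented reduced matrix -/

variable (root : V)

/-- Extend a function by the value `0` at the root. -/
def extendRoot (q : {v // v ≠ root} → K) (v : V) : K := if h : v = root then 0 else q ⟨v, h⟩

theorem extendRoot_root (q : {v // v ≠ root} → K) : extendRoot root q root = 0 := dif_pos rfl

theorem extendRoot_coe (q : {v // v ≠ root} → K) (v : {v // v ≠ root}) :
    extendRoot root q v = q v := dif_neg v.2

theorem sum_mul_extendRoot (F : V → K) (q : {v // v ≠ root} → K) :
    ∑ v : {v // v ≠ root}, F v * q v = ∑ v, F v * extendRoot root q v := by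
  rw [← Fintype.sum_subtype_add_sum_subtype (fun v => v ≠ root)]
  simp only [extendRoot_coe]
  rw [left_eq_add]
  refine Finset.sum_eq_zero fun v _ => ?_
  rw [not_not.1 v.2, extendRoot_root, mul_zero]

theorem sum_total_mul_extendRoot (l : Λ) (q : {v // v ≠ root} → K) :
    ∑ v : {v // v ≠ root}, ((∑ i : Fin (G.deg v.1), G.eps l ⟨v.1, i⟩ : ℤ) : K) * q v =
      extendRoot root q (G.head l).1 - extendRoot root q (G.tail l).1 := by
  rw [sum_mul_extendRoot root (fun v => ((∑ i : Fin (G.deg v), G.eps l ⟨v, i⟩ : ℤ) : K)),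
    ← G.sum_eps_mul l (fun c => extendRoot root q c.1), Fintype.sum_sigma]
  simp only [Int.cast_sum, Finset.sum_mul]

theorem sum_total_mul_flow (x : Λ → K) (v : V) :
    ∑ l, ((∑ i : Fin (G.deg v), G.eps l ⟨v, i⟩ : ℤ) : K) * x l = G.total (G.flow x) v := by
  simp only [Int.cast_sum, Finset.sum_mul, total, flow]
  exact Finset.sum_comm

/-- The row of a line is the difference, between head and tail, of a potential on the corners made
of the integrated flow and the hypermomentum. -/
theorem reducedBOriented_mulVec_inl (y : Λ ⊕ {v // v ≠ root} → K) (l : Λ) :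
    ((G.reducedBOriented root).map (Int.cast : ℤ → K)).mulVec y (Sum.inl l) =
      (2 * G.tailSum (G.flow (y ∘ Sum.inl)) (G.head l) - G.flow (y ∘ Sum.inl) (G.head l)
        - G.total (G.flow (y ∘ Sum.inl)) (G.head l).1 + extendRoot root (y ∘ Sum.inr) (G.head l).1)
      - (2 * G.tailSum (G.flow (y ∘ Sum.inl)) (G.tail l) - G.flow (y ∘ Sum.inl) (G.tail l)
        - G.total (G.flow (y ∘ Sum.inl)) (G.tail l).1
        + extendRoot root (y ∘ Sum.inr) (G.tail l).1) := by
  set x := y ∘ Sum.inl with hx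
  have h1 : ∑ l', ((∑ v, ∑ i : Fin (G.deg v), ∑ j : Fin (G.deg v),
      omega i j * G.eps l ⟨v, i⟩ * G.eps l' ⟨v, j⟩ : ℤ) : K) * x l' =
      ∑ c : G.Corner, (G.eps l c : K) *
        (2 * G.tailSum (G.flow x) c - G.flow x c - G.total (G.flow x) c.1) := by
    rw [Fintype.sum_sigma]
    have h3 : ∀ v (i : Fin (G.deg v)), (G.eps l ⟨v, i⟩ : K) * (2 * G.tailSum (G.flow x) ⟨v, i⟩ -
        G.flow x ⟨v, i⟩ - G.total (G.flow x) v) =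
        ∑ j, ∑ l', (G.eps l ⟨v, i⟩ : K) * ((omega i j : K) * (G.eps l' ⟨v, j⟩ * x l')) := by
      intro v i
      rw [← sum_omega]
      simp only [flow, Finset.mul_sum]
    simp only [h3, Int.cast_sum, Finset.sum_mul]
    rw [Finset.sum_comm]
    refine Finset.sum_congr rfl fun v _ => ?_
    rw [Finset.sum_comm]
    refine Finset.sum_congr rfl fun i _ => ?_
    rw [Finset.sum_comm]
    refine Finset.sum_congr rfl fun j _ => Finset.sum_congr rfl fun l' _ => ?_
    push_cast
    ring
  rw [sum_eps_mul] at h1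
  have h2 := G.sum_total_mul_extendRoot root l (y ∘ Sum.inr)
  have h3 : ((G.reducedBOriented root).map (Int.cast : ℤ → K)).mulVec y (Sum.inl l) =
      ∑ l', ((∑ v, ∑ i : Fin (G.deg v), ∑ j : Fin (G.deg v),
        omega i j * G.eps l ⟨v, i⟩ * G.eps l' ⟨v, j⟩ : ℤ) : K) * x l' +
      ∑ v : {v // v ≠ root}, ((∑ i : Fin (G.deg v.1), G.eps l ⟨v.1, i⟩ : ℤ) : K) *
        (y ∘ Sum.inr) v := by
    simp only [Matrix.mulVec, dotProduct, Fintype.sum_sum_type]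
    rfl
  rw [h3, h1, h2]
  ring

theorem reducedBOriented_mulVec_inr (y : Λ ⊕ {v // v ≠ root} → K) (v : {v // v ≠ root}) :
    ((G.reducedBOriented root).map (Int.cast : ℤ → K)).mulVec y (Sum.inr v) =
      -G.total (G.flow (y ∘ Sum.inl)) v := by
  rw [← sum_total_mul_flow]
  simp [Matrix.mulVec, dotProduct, Fintype.sum_sum_type, reducedBOriented]

end Flow

end FeynmanGraph

namespace FeynmanGraph

variable {V Λ : Type*} (G : FeynmanGraph V Λ) [DecidableEq V] [DecidableEq Λ] [Fintype V]
  [Fintype Λ] {K : Type*} [CommRing K] (root : V)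

/-! ### The determinants of the reduced matrices -/

/-- The matrix obtained from the oriented reduced matrix by integrating the flows along the
vertices; it is unimodular when there is a single face. -/
def integratedB : Matrix (Λ ⊕ {v // v ≠ root}) (Λ ⊕ {v // v ≠ root}) ℤ :=
  Matrix.fromBlocks
    (Matrix.of fun l l' => G.tailSum (G.eps l') (G.head l) - G.tailSum (G.eps l') (G.tail l) -
      if l = l' then 1 else 0)
    (Matrix.of fun l v => ∑ i : Fin (G.deg v.1), G.eps l ⟨v.1, i⟩)
    (Matrix.of fun v l => -∑ i : Fin (G.deg v.1), G.eps l ⟨v.1, i⟩)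
    0

theorem sum_tailSum_mul (x : Λ → K) (c : G.Corner) :
    ∑ l, ((G.tailSum (G.eps l) c : ℤ) : K) * x l = G.tailSum (G.flow x) c := by
  simp only [tailSum, Int.cast_sum, Finset.sum_mul, flow]
  rw [Finset.sum_comm]
  refine Finset.sum_congr rfl fun j _ => ?_
  split_ifs <;> simp

theorem integratedB_mulVec_inl (y : Λ ⊕ {v // v ≠ root} → K) (l : Λ) :
    ((G.integratedB root).map (Int.cast : ℤ → K)).mulVec y (Sum.inl l) =
      (G.tailSum (G.flow (y ∘ Sum.inl)) (G.head l) + extendRoot root (y ∘ Sum.inr) (G.head l).1) -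
      (G.tailSum (G.flow (y ∘ Sum.inl)) (G.tail l) + extendRoot root (y ∘ Sum.inr) (G.tail l).1) -
      y (Sum.inl l) := by
  set x := y ∘ Sum.inl with hx
  have h2 := G.sum_total_mul_extendRoot root l (y ∘ Sum.inr)
  have h3 : ((G.integratedB root).map (Int.cast : ℤ → K)).mulVec y (Sum.inl l) =
      ∑ l', ((G.tailSum (G.eps l') (G.head l) - G.tailSum (G.eps l') (G.tail l) -
      if l = l' then 1 else 0 : ℤ) : K) * x l' +
      ∑ v : {v // v ≠ root}, ((∑ i : Fin (G.deg v.1), G.eps l ⟨v.1, i⟩ : ℤ) : K) *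
        (y ∘ Sum.inr) v := by
    simp only [Matrix.mulVec, dotProduct, Fintype.sum_sum_type]
    rfl
  rw [h3, h2]
  simp only [Int.cast_sub, sub_mul, Finset.sum_sub_distrib, sum_tailSum_mul]
  simp [hx]
  ring

theorem integratedB_mulVec_inr (y : Λ ⊕ {v // v ≠ root} → K) (v : {v // v ≠ root}) :
    ((G.integratedB root).map (Int.cast : ℤ → K)).mulVec y (Sum.inr v) =
      -G.total (G.flow (y ∘ Sum.inl)) v := by
  rw [← sum_total_mul_flow]
  simp [Matrix.mulVec, dotProduct, Fintype.sum_sum_type, integratedB]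

theorem total_root_eq_zero (x : Λ → K) (h : ∀ v, v ≠ root → G.total (G.flow x) v = 0) (v : V) :
    G.total (G.flow x) v = 0 := by
  by_cases hv : v = root
  · subst hv
    have h1 := G.sum_flow x
    rw [Fintype.sum_sigma, Finset.sum_eq_single v] at h1
    · exact h1
    · exact fun w _ hw => h w hw
    · simp
  · exact h v hv

/-- The potential `b` satisfies `b (next c) = b (opp c)`, so it is constant along faces, hence
constant. Then the flow, which is minus the increment of `b` along `next`, vanishes, and `b` reduces
to the hypermomenta, which equal the value 0 at the root. No division occurs, so `K` may be a field
of any characteristic. -/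
theorem eq_zero_of_integratedB_mulVec (hF : G.numFaces = 1) (y : Λ ⊕ {v // v ≠ root} → K)
    (hy : ((G.integratedB root).map (Int.cast : ℤ → K)).mulVec y = 0) : y = 0 := by
  have : Nonempty V := ⟨root⟩
  rw [numFaces_eq_one_iff] at hF
  set x := y ∘ Sum.inl with hx
  set q := extendRoot root (y ∘ Sum.inr) with hq
  have htot : ∀ v, G.total (G.flow x) v = 0 := by
    refine G.total_root_eq_zero root x fun v hv => ?_
    have := congrFun hy (Sum.inr ⟨v, hv⟩)
    rw [integratedB_mulVec_inr] at this
    exact neg_eq_zero.1 this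
  let b : G.Corner → K := fun c => G.tailSum (G.flow x) c + q c.1
  have hnext : ∀ c, b (G.next c) = b c - G.flow x c := by
    intro c
    show G.tailSum (G.flow x) (G.next c) + q c.1 = _
    rw [G.tailSum_next htot]
    ring
  have hline : ∀ l, b (G.head l) - b (G.tail l) = x l := by
    intro l
    have := congrFun hy (Sum.inl l)
    rw [integratedB_mulVec_inl] at this
    exact sub_eq_zero.1 this
  have hopp : ∀ c, b (G.next c) = b (G.ribbon.opp c) := by
    intro c
    rw [hnext]
    rcases G.ribbon.corner_cases c with ⟨l, rfl⟩ | ⟨l, rfl⟩ | hc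
    · rw [RibbonGraph.opp_tail]
      show b (G.tail l) - G.flow x (G.tail l) = b (G.head l)
      rw [flow_tail]
      linear_combination -hline l
    · rw [RibbonGraph.opp_head]
      show b (G.head l) - G.flow x (G.head l) = b (G.tail l)
      rw [flow_head]
      linear_combination hline l
    · rw [RibbonGraph.opp_external _ hc, G.flow_external x hc, sub_zero]
  have hconst : ∀ c d, b c = b d := by
    intro c d
    refine (sameCycle_invariant (P := fun e => b c = b e) (fun e => ?_) (hF c d)).1 rfl
    show b c = b (G.next (G.ribbon.opp e)) ↔ _
    rw [hopp, RibbonGraph.opp_opp]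
  have hflow : ∀ c, G.flow x c = 0 := by
    intro c
    have := hnext c
    rw [hconst (G.next c) c] at this
    linear_combination this
  have hx0 : ∀ l, x l = 0 := fun l => by rw [← G.flow_head x l, hflow]
  have hb : ∀ c, b c = q c.1 := by
    intro c
    simp only [b, tailSum, hflow, ite_self, Finset.sum_const_zero, zero_add]
  have hq0 : ∀ v, q v = 0 := by
    intro v
    have := hconst ⟨v, ⟨0, G.deg_pos v⟩⟩ ⟨root, ⟨0, G.deg_pos root⟩⟩
    rw [hb, hb] at this
    exact this.trans (extendRoot_root root _)
  funext z
  rcases z with l | v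
  · exact hx0 l
  · have := hq0 v
    rw [hq, extendRoot_coe] at this
    exact this

/-- A prime dividing the determinant would give a nonzero kernel vector over `ZMod p`; this includes
the case of determinant 0. -/
theorem natAbs_det_integratedB (hF : G.numFaces = 1) : (G.integratedB root).det.natAbs = 1 := by
  by_contra hne
  obtain ⟨p, hp, hdvd⟩ := Nat.exists_prime_and_dvd hne
  have : Fact p.Prime := ⟨hp⟩
  have h1 : ((G.integratedB root).det : ZMod p) = 0 := by
    rw [ZMod.intCast_zmod_eq_zero_iff_dvd]
    exact Int.natCast_dvd.2 hdvd
  have h2 : ((G.integratedB root).map (Int.cast : ℤ → ZMod p)).det = 0 := by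
    rw [← h1]
    exact ((Int.castRingHom (ZMod p)).map_det _).symm
  obtain ⟨y, hy, hy0⟩ := Matrix.exists_mulVec_eq_zero_iff.2 h2
  exact hy (G.eq_zero_of_integratedB_mulVec root hF y hy0)

/-- Substituting `2 * q v + total v - total root` for the hypermomentum cancels the term `-total` in
the potential and makes the rows of the lines divisible by 2. The constant `total root` keeps the
value 0 at the root and drops out of differences between head and tail. -/
theorem reducedBOriented_factor : ∃ T : Matrix {v // v ≠ root} Λ ℤ,
    G.reducedBOriented root * Matrix.fromBlocks 1 0 T (Matrix.diagonal fun _ => 2) =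
      Matrix.fromBlocks (Matrix.diagonal fun _ => 2) 0 0 1 * G.integratedB root := by
  have hmap : ∀ M : Matrix (Λ ⊕ {v // v ≠ root}) (Λ ⊕ {v // v ≠ root}) ℤ,
      M.map (Int.cast : ℤ → ℤ) = M := by
    intro M
    ext
    simp
  refine ⟨Matrix.of fun v l => (∑ i : Fin (G.deg v.1), G.eps l ⟨v.1, i⟩) -
    ∑ i : Fin (G.deg root), G.eps l ⟨root, i⟩, ?_⟩
  refine Matrix.ext_of_mulVec_single fun z => ?_
  generalize Pi.single (M := fun _ => ℤ) z 1 = y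
  rw [← Matrix.mulVec_mulVec, ← Matrix.mulVec_mulVec]
  set x := y ∘ Sum.inl with hx
  set w := (Matrix.fromBlocks (1 : Matrix Λ Λ ℤ) (0 : Matrix Λ {v // v ≠ root} ℤ)
    (Matrix.of fun (v : {v // v ≠ root}) l => (∑ i : Fin (G.deg v.1), G.eps l ⟨v.1, i⟩) -
    ∑ i : Fin (G.deg root), G.eps l ⟨root, i⟩) (Matrix.diagonal fun _ => 2)).mulVec y with hw
  have hwl : w ∘ Sum.inl = x := by
    rw [hw, Matrix.fromBlocks_mulVec]
    simp [hx]
  have hwr : ∀ v, extendRoot root (w ∘ Sum.inr) v = G.total (G.flow x) v -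
      G.total (G.flow x) root + 2 * extendRoot root (y ∘ Sum.inr) v := by
    intro v
    by_cases hv : v = root
    · subst hv
      rw [extendRoot_root, extendRoot_root]
      ring
    · rw [show extendRoot root (w ∘ Sum.inr) v = _ from extendRoot_coe root _ ⟨v, hv⟩,
        show extendRoot root (y ∘ Sum.inr) v = _ from extendRoot_coe root _ ⟨v, hv⟩, hw,
        Matrix.fromBlocks_mulVec, ← sum_total_mul_flow, ← sum_total_mul_flow,
        ← Finset.sum_sub_distrib]
      simp only [Function.comp_apply, Sum.elim_inr, Pi.add_apply, Matrix.mulVec_diagonal]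
      congr 1
      simp only [Matrix.mulVec, dotProduct, Matrix.of_apply, sub_mul, Int.cast_id]
      rfl
  rw [Matrix.fromBlocks_mulVec (Matrix.diagonal fun _ => (2 : ℤ))]
  have h1 := G.reducedBOriented_mulVec_inl root w
  have h2 := G.reducedBOriented_mulVec_inr root w
  have h3 := G.integratedB_mulVec_inl root y
  have h4 := G.integratedB_mulVec_inr root y
  rw [hmap] at h1 h2 h3 h4
  funext z
  rcases z with l | v
  · rw [h1, hwl, hwr, hwr]
    simp only [Matrix.zero_mulVec, add_zero, Sum.elim_inl, Matrix.mulVec_diagonal,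
      Function.comp_apply, h3, flow_head, flow_tail]
    rw [show y (Sum.inl l) = x l from rfl]
    ring
  · rw [h2, hwl]
    simp [h4, hx]

theorem reducedBOriented_skew (a b : Λ ⊕ {v // v ≠ root}) :
    G.reducedBOriented root a b = -G.reducedBOriented root b a := by
  rcases a with l | v <;> rcases b with l' | v'
  · simp only [reducedBOriented, Matrix.fromBlocks_apply₁₁, Matrix.of_apply,
      ← Finset.sum_neg_distrib]
    refine Finset.sum_congr rfl fun v _ => ?_
    rw [Finset.sum_comm]
    refine Finset.sum_congr rfl fun i _ => Finset.sum_congr rfl fun j _ => ?_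
    have : omega j i = -omega i j := by
      unfold omega
      rcases lt_trichotomy i j with h | h | h
      · simp [h, h.not_gt]
      · simp [h]
      · simp [h, h.not_gt]
    rw [this]
    ring
  · simp [reducedBOriented]
  · simp [reducedBOriented]
  · simp [reducedBOriented]

theorem det_nonneg_of_skew {ι : Type*} [Fintype ι] [DecidableEq ι] (M : Matrix ι ι ℤ)
    (hM : ∀ a b, M a b = -M b a) : 0 ≤ M.det := by
  rw [← Matrix.det_submatrix_equiv_self (Fintype.equivFin ι).symm,
    ← pfaffian_sq (M.submatrix _ _) fun a b => hM _ _]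
  exact sq_nonneg _

theorem even_card_of_skew {ι : Type*} [Fintype ι] [DecidableEq ι] (M : Matrix ι ι ℤ)
    (hM : ∀ a b, M a b = -M b a) (h : M.det ≠ 0) : Even (Fintype.card ι) := by
  by_contra hodd
  rw [Nat.not_even_iff_odd] at hodd
  have h1 : M.transpose = -M := by
    ext i j
    exact hM j i
  have h2 : M.det = -M.det := by
    conv_lhs => rw [← Matrix.det_transpose, h1, Matrix.det_neg, hodd.neg_one_pow]
    ring
  omega

theorem card_ne_root : Fintype.card {v // v ≠ root} + 1 = Fintype.card V := by
  have := Fintype.card_pos_iff.2 ⟨root⟩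
  rw [Fintype.card_subtype_compl, Fintype.card_subtype_eq]
  omega

/-- The factorisation gives the equality up to the sign of the unimodular determinant; nonnegativity
of the skew determinant excludes the minus sign. -/
theorem det_reducedBOriented_mul (hF : G.numFaces = 1) :
    (G.reducedBOriented root).det * 2 ^ Fintype.card {v // v ≠ root} = 2 ^ Fintype.card Λ := by
  obtain ⟨T, hT⟩ := G.reducedBOriented_factor root
  have h := congrArg Matrix.det hT
  rw [Matrix.det_mul, Matrix.det_mul, Matrix.det_fromBlocks_zero₁₂, Matrix.det_fromBlocks_zero₁₂,
    Matrix.det_diagonal, Matrix.det_diagonal, Matrix.det_one, Matrix.det_one,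
    Finset.prod_const, Finset.prod_const, Finset.card_univ, Finset.card_univ, one_mul, mul_one] at h
  have hpos := det_nonneg_of_skew _ (G.reducedBOriented_skew root)
  have h1 : 0 ≤ (G.reducedBOriented root).det * 2 ^ Fintype.card {v // v ≠ root} := by positivity
  rcases Int.natAbs_eq (G.integratedB root).det with h2 | h2 <;>
    rw [G.natAbs_det_integratedB root hF] at h2 <;> rw [h2] at h
  · simpa using h
  · rw [h] at h1
    have : (0 : ℤ) < 2 ^ Fintype.card Λ := by positivity
    push_cast at h1
    linarith

theorem det_reducedBOriented_ne_zero (hF : G.numFaces = 1) : (G.reducedBOriented root).det ≠ 0 := by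
  intro h
  have := G.det_reducedBOriented_mul root hF
  rw [h, zero_mul] at this
  exact absurd this.symm (by positivity)

/-- The Euler characteristic has the parity it should have. -/
theorem even_of_numFaces_eq_one [Nonempty V] (hF : G.numFaces = 1) :
    Even (Fintype.card Λ + Fintype.card V + 1) := by
  obtain ⟨root⟩ := ‹Nonempty V›
  have h := even_card_of_skew _ (G.reducedBOriented_skew root)
    (G.det_reducedBOriented_ne_zero root hF)
  rw [Fintype.card_sum] at h
  have := card_ne_root root
  rw [← this, show Fintype.card Λ + (Fintype.card {v // v ≠ root} + 1) + 1 =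
    Fintype.card Λ + Fintype.card {v // v ≠ root} + 2 by ring]
  exact h.add even_two

/-- Deleting a tree of the dual graph removes `F - 1` lines and leaves one face, which reduces the
parity to the previous case. -/
theorem Connected.even {G : FeynmanGraph V Λ} (hG : G.Connected) :
    Even (Fintype.card Λ + Fintype.card V + G.numFaces) := by
  cases isEmpty_or_nonempty V with
  | inl h =>
    have : IsEmpty Λ := ⟨fun l => h.elim (G.head l).1⟩
    have : IsEmpty G.ribbon.Face := ⟨fun f => by
      obtain ⟨c, -⟩ := G.ribbon.faceOf_surjective f
      exact h.elim c.1⟩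
    simp [numFaces]
  | inr h =>
    obtain ⟨J, hJ⟩ := hG.exists_isDualTree
    have h1 := (G.deleteLines J).even_of_numFaces_eq_one
      (G.numFaces_deleteLines_of_isDualTree hJ)
    have h2 := G.isDualTree_card hJ
    have h3 := J.card_le_univ
    rw [Fintype.card_subtype_compl, Fintype.card_coe] at h1
    rw [Nat.even_iff] at h1 ⊢
    omega

/-- Euler's relation. -/
theorem Connected.two_mul_genus {G : FeynmanGraph V Λ} [Nonempty V] (hG : G.Connected) :
    2 * (G.genus : ℤ) = 2 - Fintype.card V + Fintype.card Λ - G.numFaces := by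
  have h1 := hG.even
  have h2 := hG.card_le
  rw [Nat.even_iff] at h1
  rw [genus]
  omega

theorem det_reducedBOriented (hF : G.numFaces = 1) :
    (G.reducedBOriented root).det = 2 ^ (2 * G.genus) := by
  have : Nonempty V := ⟨root⟩
  have h1 := G.det_reducedBOriented_mul root hF
  have h2 := (G.connected_of_numFaces_eq_one hF).two_mul_genus
  have h3 := card_ne_root root
  have h4 : Fintype.card Λ = 2 * G.genus + Fintype.card {v // v ≠ root} := by
    rw [hF] at h2
    omega
  rw [h4, pow_add] at h1
  exact mul_right_cancel₀ (by positivity) h1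

end FeynmanGraph

namespace FeynmanGraph

variable {V Λ : Type*} (G : FeynmanGraph V Λ) [DecidableEq V] [DecidableEq Λ] [Fintype V]
  [Fintype Λ] {K : Type*} [CommRing K] (root : V)

/-! ### Orientable graphs -/

/-- For orientable graphs, the reduced matrix takes its oriented form after changing the signs of
some of the variables. -/
theorem Orientable.reducedB_eq {G : FeynmanGraph V Λ} (hG : G.Orientable) :
    ∃ d : Λ ⊕ {v // v ≠ root} → ℤ, (∀ a, d a * d a = 1) ∧
      ∀ a b, G.reducedB root a b = -(d a * G.reducedBOriented root a b * d b) := by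
  obtain ⟨χ, hnext, hline⟩ := hG
  have hχ : ∀ v i (hi : i < G.deg v),
      (χ ⟨v, ⟨i, hi⟩⟩ : ℤ) = (-1) ^ i * (χ ⟨v, ⟨0, G.deg_pos v⟩⟩ : ℤ) := by
    intro v i
    induction i with
    | zero => intro _; simp
    | succ i ih =>
      intro hi
      rw [← G.next_mk_of_lt v i hi, hnext, Units.val_neg, ih, pow_succ]
      ring
  have hsq : ∀ c, (χ c : ℤ) * χ c = 1 := fun c => by
    rw [← Units.val_mul, Int.units_mul_self, Units.val_one]
  -- Alternating signs factor through `χ`; since `χ` is opposite at the two ends of a line, it also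
  -- converts `eta` into `eps` (`heta`).
  have hpow : ∀ v (i : Fin (G.deg v)),
      (-1 : ℤ) ^ (i : ℕ) = χ ⟨v, ⟨0, G.deg_pos v⟩⟩ * χ ⟨v, i⟩ := by
    intro v i
    rw [hχ v i i.2]
    linear_combination -((-1 : ℤ) ^ (i : ℕ)) * hsq ⟨v, ⟨0, G.deg_pos v⟩⟩
  have heta : ∀ l c, (χ c : ℤ) * G.eta l c = χ (G.head l) * G.eps l c := by
    intro l c
    unfold eta eps
    split_ifs with h1 h2
    · simp [h1]
    · rw [← h2, hline, Units.val_neg]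
      simp
    · simp
  have hC : ∀ l v, G.alternating v (G.eta l) =
      χ ⟨v, ⟨0, G.deg_pos v⟩⟩ * χ (G.head l) * ∑ i : Fin (G.deg v), G.eps l ⟨v, i⟩ := by
    intro l v
    rw [alternating, Finset.mul_sum]
    refine Finset.sum_congr rfl fun i _ => ?_
    rw [hpow]
    linear_combination (χ ⟨v, ⟨0, G.deg_pos v⟩⟩ : ℤ) * heta l ⟨v, i⟩
  refine ⟨Sum.elim (fun l => χ (G.head l)) (fun v => -χ ⟨v, ⟨0, G.deg_pos v⟩⟩), ?_, ?_⟩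
  · rintro (l | v)
    · exact hsq _
    · simp
  · rintro (l | v) (l' | v')
    · simp only [reducedB, reducedBOriented, Matrix.fromBlocks_apply₁₁, Evv, Matrix.of_apply,
        Sum.elim_inl, oscillation, Finset.mul_sum, Finset.sum_mul, ← Finset.sum_neg_distrib]
      refine Finset.sum_congr rfl fun v _ => Finset.sum_congr rfl fun i _ =>
        Finset.sum_congr rfl fun j _ => ?_
      have h1 := heta l ⟨v, i⟩
      have h2 := heta l' ⟨v, j⟩
      rw [pow_succ, pow_add, hpow, hpow]
      have h3 := hsq ⟨v, ⟨0, G.deg_pos v⟩⟩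
      generalize (χ ⟨v, ⟨0, G.deg_pos v⟩⟩ : ℤ) = a at h3 ⊢
      calc _ = -(a * a) * omega i j * ((χ ⟨v, i⟩ : ℤ) * G.eta l ⟨v, i⟩) *
            ((χ ⟨v, j⟩ : ℤ) * G.eta l' ⟨v, j⟩) := by ring
        _ = _ := by rw [h3, h1, h2]; ring
    · simp only [reducedB, reducedBOriented, Matrix.fromBlocks_apply₁₂, Cv, Matrix.of_apply,
        Sum.elim_inl, Sum.elim_inr, hC]
      ring
    · simp only [reducedB, reducedBOriented, Matrix.fromBlocks_apply₂₁, Cv, Matrix.of_apply,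
        Sum.elim_inl, Sum.elim_inr, hC, Matrix.neg_apply, Matrix.transpose_apply]
      ring
    · simp [reducedB, reducedBOriented]

theorem Orientable.det_reducedB {G : FeynmanGraph V Λ} (hG : G.Orientable) :
    (G.reducedB root).det = (G.reducedBOriented root).det := by
  obtain ⟨d, hd, h⟩ := hG.reducedB_eq root
  have h1 : G.reducedB root =
      -(Matrix.diagonal d * G.reducedBOriented root * Matrix.diagonal d) := by
    ext a b
    rw [h, Matrix.neg_apply, Matrix.mul_diagonal, Matrix.diagonal_mul]
  have h2 : (∏ a, d a) * ∏ a, d a = 1 := by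
    rw [← Finset.prod_mul_distrib]
    exact Finset.prod_eq_one fun a _ => hd a
  rw [h1, Matrix.det_neg, Matrix.det_mul, Matrix.det_mul, Matrix.det_diagonal]
  by_cases h0 : (G.reducedBOriented root).det = 0
  · rw [h0]
    ring
  · rw [(even_card_of_skew _ (G.reducedBOriented_skew root) h0).neg_one_pow]
    linear_combination (G.reducedBOriented root).det * h2

/-! ### The kernel of the reduced matrices -/

/-- The vector of the kernel of the oriented reduced matrix given by a function on the faces. -/
def faceVector (g : G.ribbon.Face → K) : Λ ⊕ {v // v ≠ root} → K :=
  Sum.elim (fun l => g (G.ribbon.faceOf (G.head l)) - g (G.ribbon.faceOf (G.tail l)))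
    (fun v => 2 * g (G.ribbon.faceOf ⟨v, ⟨0, G.deg_pos v⟩⟩))

/-- Integrating the flow at a vertex recovers the potential `b` up to its value at the first corner.
The hypermomentum restores that value, with a factor 2 because the matrix contains `2 * tailSum`. -/
theorem reducedBOriented_mulVec_faceVector (g : G.ribbon.Face → K)
    (hg : g (G.ribbon.faceOf ⟨root, ⟨0, G.deg_pos root⟩⟩) = 0) :
    ((G.reducedBOriented root).map (Int.cast : ℤ → K)).mulVec (G.faceVector root g) = 0 := by
  let b : G.Corner → K := fun c => g (G.ribbon.faceOf c)
  have hnext : ∀ c, b (G.next c) = b (G.ribbon.opp c) := fun c =>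
    congrArg g (G.ribbon.faceOf_next c)
  set x : Λ → K := G.faceVector root g ∘ Sum.inl with hx
  have hxl : ∀ l, x l = b (G.head l) - b (G.tail l) := fun l => rfl
  have hflow : ∀ c, G.flow x c = b c - b (G.next c) := by
    intro c
    rw [hnext]
    rcases G.ribbon.corner_cases c with ⟨l, rfl⟩ | ⟨l, rfl⟩ | hc
    · rw [RibbonGraph.opp_tail]
      show G.flow x (G.tail l) = b (G.tail l) - b (G.head l)
      rw [flow_tail, hxl]
      ring
    · rw [RibbonGraph.opp_head]
      show G.flow x (G.head l) = b (G.head l) - b (G.tail l)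
      rw [flow_head, hxl]
    · rw [RibbonGraph.opp_external _ hc, G.flow_external x hc, sub_self]
  have htot : ∀ v, G.total (G.flow x) v = 0 := by
    intro v
    simp only [total, hflow, Finset.sum_sub_distrib]
    rw [sub_eq_zero, ← Equiv.sum_comp (finRotate (G.deg v)) fun i => b ⟨v, i⟩]
    rfl
  have htail : ∀ c, G.tailSum (G.flow x) c = b c - b ⟨c.1, ⟨0, G.deg_pos c.1⟩⟩ := by
    intro c
    have h := (sameCycle_invariant (π := G.next)
      (P := fun e => G.tailSum (G.flow x) e - b e = G.tailSum (G.flow x) c - b c) (fun e => by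
        rw [G.tailSum_next htot, hflow, sub_sub, sub_add_cancel])
      (G.sameCycle_next_of_fst_eq c ⟨c.1, ⟨0, G.deg_pos c.1⟩⟩ rfl)).1 rfl
    rw [tailSum_zero, htot] at h
    linear_combination -h
  have hext : ∀ v, extendRoot root (G.faceVector root g ∘ Sum.inr) v =
      2 * b ⟨v, ⟨0, G.deg_pos v⟩⟩ := by
    intro v
    by_cases hv : v = root
    · subst hv
      rw [extendRoot_root]
      show 0 = 2 * g _
      rw [hg, mul_zero]
    · exact extendRoot_coe root _ ⟨v, hv⟩
  funext z
  rcases z with l | v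
  · rw [reducedBOriented_mulVec_inl, ← hx, htail, htail, htot, htot, hext, hext, flow_head,
      flow_tail, hxl, Pi.zero_apply]
    ring
  · rw [reducedBOriented_mulVec_inr, ← hx, htot, Pi.zero_apply, neg_zero]

/-- The hypermomenta give the value 0 at every first corner, and the vanishing differences carry it
around each vertex. The normalised functions on the faces thus embed in the kernel, with dimension
`F - 1`. -/
theorem eq_zero_of_faceVector_eq_zero (g : G.ribbon.Face → ℚ)
    (hg : g (G.ribbon.faceOf ⟨root, ⟨0, G.deg_pos root⟩⟩) = 0)
    (h : G.faceVector root g = 0) : g = 0 := by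
  have h1 : ∀ l, g (G.ribbon.faceOf (G.head l)) = g (G.ribbon.faceOf (G.tail l)) :=
    fun l => sub_eq_zero.1 (congrFun h (Sum.inl l))
  have h2 : ∀ v, g (G.ribbon.faceOf ⟨v, ⟨0, G.deg_pos v⟩⟩) = 0 := by
    intro v
    by_cases hv : v = root
    · subst hv
      exact hg
    · have := congrFun h (Sum.inr ⟨v, hv⟩)
      simpa [faceVector] using this
  funext f
  obtain ⟨c, rfl⟩ := G.ribbon.faceOf_surjective f
  refine (sameCycle_invariant (π := G.next) (P := fun c => g (G.ribbon.faceOf c) = 0)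
    (fun c => ?_) (G.sameCycle_next_of_fst_eq ⟨c.1, ⟨0, G.deg_pos c.1⟩⟩ c rfl)).1 (h2 c.1)
  rw [show G.ribbon.faceOf (G.next c) = _ from G.ribbon.faceOf_next c]
  rcases G.ribbon.corner_cases c with ⟨l, rfl⟩ | ⟨l, rfl⟩ | hc
  · rw [RibbonGraph.opp_tail]
    exact Eq.congr_left (h1 l)
  · rw [RibbonGraph.opp_head]
    exact Eq.congr_left (h1 l).symm
  · rw [RibbonGraph.opp_external _ hc]

/-! ### The integers `n_{I,J}` -/

theorem oscillation_skew (f h : G.Corner → ℤ) : G.oscillation f h = -G.oscillation h f := by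
  simp only [oscillation, ← Finset.sum_neg_distrib]
  refine Finset.sum_congr rfl fun v _ => ?_
  rw [Finset.sum_comm]
  refine Finset.sum_congr rfl fun i _ => Finset.sum_congr rfl fun j _ => ?_
  have : omega j i = -omega i j := by
    unfold omega
    rcases lt_trichotomy i j with h | h | h
    · simp [h, h.not_gt]
    · simp [h]
    · simp [h, h.not_gt]
  rw [this, add_comm (j : ℕ)]
  ring

theorem Bprime_skew (a b : Index V Λ root) : G.Bprime root a b = -G.Bprime root b a := by
  rcases a with (l | l) | v <;> rcases b with (l' | l') | v' <;>
    simp [Bprime, E, C, Euu, Euv, Evv, ← oscillation_skew]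

open Classical in
theorem nIJ_sq (e : Ordering V Λ root) (I J : Finset Λ) :
    G.nIJ root e I J ^ 2 =
      ((G.Bprime root).submatrix (Subtype.val : {x // Kept root I J x} → _) Subtype.val).det := by
  rw [nIJ, pfaffian_sq, ← Matrix.det_submatrix_equiv_self (e I J)]
  · rfl
  · exact fun a b => G.Bprime_skew root _ _

/-- The surviving indices when all short variables are deleted. -/
def keptUnivEquiv (J : Finset Λ) :
    {l // l ∉ J} ⊕ {v // v ≠ root} ≃ {x : Index V Λ root // Kept root Finset.univ J x} where
  toFun := Sum.elim (fun l => ⟨Sum.inl (Sum.inr l.1), l.2⟩) (fun v => ⟨Sum.inr v, trivial⟩)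
  invFun x := match x with
    | ⟨Sum.inl (Sum.inl l), h⟩ => absurd (Finset.mem_univ l) h
    | ⟨Sum.inl (Sum.inr l), h⟩ => Sum.inl ⟨l, h⟩
    | ⟨Sum.inr v, _⟩ => Sum.inr v
  left_inv := by
    rintro (l | v) <;> rfl
  right_inv := by
    rintro ⟨(l | l) | v, h⟩
    · exact absurd (Finset.mem_univ l) h
    · rfl
    · rfl

/-- Deleting lines leaves the numbering of the corners untouched, so the remaining entries of `B'`
are literally those of the smaller graph. -/
theorem nIJ_univ_sq (e : Ordering V Λ root) (J : Finset Λ) :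
    G.nIJ root e Finset.univ J ^ 2 = ((G.deleteLines J).reducedB root).det := by
  classical
  rw [nIJ_sq, ← Matrix.det_submatrix_equiv_self (keptUnivEquiv root J)]
  congr 1
  ext (l | v) (l' | v') <;> rfl

theorem exists_faceVector {ι : Type*} [Fintype ι] (φ : (Λ ⊕ {v // v ≠ root} → ℚ) →ₗ[ℚ] (ι → ℚ))
    (h : Fintype.card ι + 1 < G.numFaces) :
    ∃ y, y ≠ 0 ∧ φ y = 0 ∧ ((G.reducedBOriented root).map (Int.cast : ℤ → ℚ)).mulVec y = 0 := by
  have := Fintype.ofFinite G.ribbon.Face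
  let Y : (G.ribbon.Face → ℚ) →ₗ[ℚ] (Λ ⊕ {v // v ≠ root} → ℚ) :=
    { toFun := G.faceVector root
      map_add' := fun g g' => by
        funext z
        rcases z with l | v <;>
          simp only [faceVector, Sum.elim_inl, Sum.elim_inr, Pi.add_apply] <;> ring
      map_smul' := fun r g => by
        funext z
        rcases z with l | v <;> simp only [faceVector, Sum.elim_inl, Sum.elim_inr, Pi.smul_apply,
          smul_eq_mul, RingHom.id_apply] <;> ring }
  let Ψ : (G.ribbon.Face → ℚ) →ₗ[ℚ] (ι → ℚ) × ℚ :=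
    (φ.comp Y).prod (LinearMap.proj (G.ribbon.faceOf ⟨root, ⟨0, G.deg_pos root⟩⟩))
  have hker : LinearMap.ker Ψ ≠ ⊥ := by
    apply LinearMap.ker_ne_bot_of_finrank_lt
    rw [Module.finrank_prod, Module.finrank_fintype_fun_eq_card,
      Module.finrank_fintype_fun_eq_card, Module.finrank_self, ← Nat.card_eq_fintype_card]
    rw [Nat.card_eq_fintype_card]
    rw [numFaces, Nat.card_eq_fintype_card] at h
    exact h
  obtain ⟨g, hg, hg0⟩ := (Submodule.ne_bot_iff _).1 hker
  have h1 : φ (G.faceVector root g) = 0 := congrArg Prod.fst hg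
  have h2 : g (G.ribbon.faceOf ⟨root, ⟨0, G.deg_pos root⟩⟩) = 0 := congrArg Prod.snd hg
  exact ⟨G.faceVector root g, fun h => hg0 (G.eq_zero_of_faceVector_eq_zero root g h2 h), h1,
    G.reducedBOriented_mulVec_faceVector root g h2⟩

theorem det_reducedBOriented_eq_zero (h : 1 < G.numFaces) : (G.reducedBOriented root).det = 0 := by
  obtain ⟨y, hy, -, hy0⟩ := G.exists_faceVector root (ι := Empty) 0 (by simpa using h)
  have := Matrix.exists_mulVec_eq_zero_iff.1 ⟨y, hy, hy0⟩
  have h1 := (Int.castRingHom ℚ).map_det (G.reducedBOriented root)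
  have h2 : (((G.reducedBOriented root).det : ℤ) : ℚ) = 0 := h1.trans this
  exact_mod_cast h2

/-- The face vectors form a space of dimension `F - 1`. If fewer than `F - 1` conditions are
imposed, namely vanishing on `J` and the equations of the short rows outside `I`, a nonzero vector
remains, and it lies in the kernel of the deleted matrix. -/
theorem Orientable.nIJ_eq_zero {G : FeynmanGraph V Λ} (hG : G.Orientable)
    (e : Ordering V Λ root) (I J : Finset Λ) (h : Iᶜ.card + J.card + 1 < G.numFaces) :
    G.nIJ root e I J = 0 := by
  classical
  obtain ⟨d, hd, hred⟩ := hG.reducedB_eq root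
  have hd0 : ∀ a, (d a : ℚ) * d a = 1 := fun a => by exact_mod_cast hd a
  -- The short components are set to 0, so the long and hypermomentum rows of `B'` only see
  -- `reducedB`; the signs `d` pass from its oriented form back to it.
  let Z : (Λ ⊕ {v // v ≠ root} → ℚ) →ₗ[ℚ] (Index V Λ root → ℚ) :=
    { toFun := fun y => Sum.elim (Sum.elim (fun _ => 0) (fun l => d (Sum.inl l) * y (Sum.inl l)))
        (fun v => d (Sum.inr v) * y (Sum.inr v))
      map_add' := fun y y' => by
        funext z
        rcases z with (l | l) | v <;>
          simp only [Sum.elim_inl, Sum.elim_inr, Pi.add_apply] <;> ring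
      map_smul' := fun r y => by
        funext z
        rcases z with (l | l) | v <;> simp only [Sum.elim_inl, Sum.elim_inr, Pi.smul_apply,
          smul_eq_mul, RingHom.id_apply] <;> ring }
  let B : Matrix (Index V Λ root) (Index V Λ root) ℚ := (G.Bprime root).map (Int.cast : ℤ → ℚ)
  let φ : (Λ ⊕ {v // v ≠ root} → ℚ) →ₗ[ℚ] (((Iᶜ : Finset Λ) ⊕ J) → ℚ) :=
    LinearMap.pi (Sum.elim
      (fun l => (LinearMap.proj (Sum.inl (Sum.inl l.1))).comp ((Matrix.mulVecLin B).comp Z))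
      (fun l => LinearMap.proj (Sum.inl l.1)))
  obtain ⟨y, hy, hφ, hRO⟩ := G.exists_faceVector root φ (by
    rw [Fintype.card_sum, Fintype.card_coe, Fintype.card_coe]
    exact h)
  have hI : ∀ l ∉ I, B.mulVec (Z y) (Sum.inl (Sum.inl l)) = 0 := fun l hl =>
    congrFun hφ (Sum.inl ⟨l, Finset.mem_compl.2 hl⟩)
  have hJ : ∀ l ∈ J, y (Sum.inl l) = 0 := fun l hl => congrFun hφ (Sum.inr ⟨l, hl⟩)
  have hrow : ∀ a : Λ ⊕ {v // v ≠ root}, ∑ b, (G.reducedB root a b : ℚ) * (d b * y b) = 0 := by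
    intro a
    have h1 := congrFun hRO a
    rw [Pi.zero_apply] at h1
    calc ∑ b, (G.reducedB root a b : ℚ) * (d b * y b) =
        -(d a * ∑ b, (G.reducedBOriented root a b : ℚ) * y b) := by
          rw [Finset.mul_sum, ← Finset.sum_neg_distrib]
          refine Finset.sum_congr rfl fun b _ => ?_
          rw [hred]
          push_cast
          linear_combination (-(d a : ℚ) * G.reducedBOriented root a b * y b) * hd0 b
      _ = 0 := by
          rw [show ∑ b, (G.reducedBOriented root a b : ℚ) * y b = 0 from h1, mul_zero, neg_zero]
  have hJrow : ∀ l, B.mulVec (Z y) (Sum.inl (Sum.inr l)) = 0 := by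
    intro l
    rw [← hrow (Sum.inl l)]
    simp [Matrix.mulVec, dotProduct, Fintype.sum_sum_type, B, Z, Bprime, E, C, reducedB]
  have hVrow : ∀ v, B.mulVec (Z y) (Sum.inr v) = 0 := by
    intro v
    rw [← hrow (Sum.inr v)]
    simp [Matrix.mulVec, dotProduct, Fintype.sum_sum_type, B, Z, Bprime, C, reducedB]
  have hZ : ∀ x, ¬ Kept root I J x → Z y x = 0 := by
    rintro ((l | l) | v) hx
    · rfl
    · show (d (Sum.inl l) : ℚ) * y (Sum.inl l) = 0
      rw [hJ l (not_not.1 hx), mul_zero]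
    · exact absurd trivial hx
  have hZ0 : (fun x : {x // Kept root I J x} => Z y x.1) ≠ 0 := by
    intro h0
    have h1 : ∀ x, Z y x = 0 := by
      intro x
      by_cases hx : Kept root I J x
      · exact congrFun h0 ⟨x, hx⟩
      · exact hZ x hx
    apply hy
    have h2 : ∀ a, (d a : ℚ) ≠ 0 := fun a h => by
      have := hd0 a
      rw [h, mul_zero] at this
      exact zero_ne_one this
    funext a
    rcases a with l | v
    · exact (mul_eq_zero.1 (h1 (Sum.inl (Sum.inr l)))).resolve_left (h2 _)
    · exact (mul_eq_zero.1 (h1 (Sum.inr v))).resolve_left (h2 _)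
  have hsub : (B.submatrix (Subtype.val : {x // Kept root I J x} → _)
      (Subtype.val : {x // Kept root I J x} → _)).mulVec
      (fun x : {x // Kept root I J x} => Z y x.1) = 0 := by
    funext x
    have h1 : (B.submatrix (Subtype.val : {x // Kept root I J x} → _)
        (Subtype.val : {x // Kept root I J x} → _)).mulVec
        (fun x : {x // Kept root I J x} => Z y x.1) x = B.mulVec (Z y) x.1 := by
      simp only [Matrix.mulVec, dotProduct, Matrix.submatrix_apply]
      rw [← Fintype.sum_subtype_add_sum_subtype (Kept root I J) (fun z => B x.1 z * Z y z)]
      rw [left_eq_add]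
      refine Finset.sum_eq_zero fun z _ => ?_
      rw [hZ z.1 z.2, mul_zero]
    rw [h1, Pi.zero_apply]
    obtain ⟨(l | l) | v, hx⟩ := x
    · exact hI l hx
    · exact hJrow l
    · exact hVrow v
  have hdet := Matrix.exists_mulVec_eq_zero_iff.1 ⟨_, hZ0, hsub⟩
  have hsq := G.nIJ_sq root e I J
  have h1 := (Int.castRingHom ℚ).map_det
    ((G.Bprime root).submatrix (Subtype.val : {x // Kept root I J x} → _) Subtype.val)
  rw [← hsq] at h1
  have h2 : ((G.nIJ root e I J ^ 2 : ℤ) : ℚ) = 0 := h1.trans hdet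
  have h3 : G.nIJ root e I J ^ 2 = 0 := by exact_mod_cast h2
  exact pow_eq_zero_iff two_ne_zero |>.1 h3

/-! ### The integers attached to admissible sets -/

theorem Orientable.nIJ_univ_ne_zero_iff {G : FeynmanGraph V Λ} (hG : G.Orientable)
    (e : Ordering V Λ root) (J : Finset Λ) :
    G.nIJ root e Finset.univ J ≠ 0 ↔ G.Admissible J := by
  have : Nonempty V := ⟨root⟩
  rw [G.admissible_iff hG, ← numFaces_eq_one_iff, ← pow_ne_zero_iff two_ne_zero,
    nIJ_univ_sq, (hG.deleteLines J).det_reducedB]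
  constructor
  · intro h
    by_contra hne
    refine h ((G.deleteLines J).det_reducedBOriented_eq_zero root ?_)
    have := (G.deleteLines J).numFaces_pos
    omega
  · exact (G.deleteLines J).det_reducedBOriented_ne_zero root

/-- Euler's relation before and after the deletion: `|J|` lines are lost and `F` drops to 1. -/
theorem Admissible.two_mul_genus {G : FeynmanGraph V Λ} [Nonempty V] (hG : G.Orientable)
    (hc : G.Connected) {J : Finset Λ} (hJ : G.Admissible J) :
    2 * ((G.deleteLines J).genus : ℤ) = 2 * G.genus - G.kJ J := by
  rw [G.admissible_iff hG, ← numFaces_eq_one_iff] at hJ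
  have h1 := ((G.deleteLines J).connected_of_numFaces_eq_one hJ).two_mul_genus
  have h2 := hc.two_mul_genus
  have h3 := J.card_le_univ
  rw [Fintype.card_subtype_compl, Fintype.card_coe, hJ, Nat.cast_sub h3] at h1
  rw [kJ]
  push_cast at h1
  omega

theorem Admissible.nIJ_univ_sq {G : FeynmanGraph V Λ} (hG : G.Orientable)
    (hc : G.Connected) {J : Finset Λ} (hJ : G.Admissible J) (e : Ordering V Λ root) :
    (G.nIJ root e Finset.univ J : ℝ) ^ 2 = 2 ^ (2 * (G.genus : ℤ) - G.kJ J) := by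
  have : Nonempty V := ⟨root⟩
  have h1 := hJ.two_mul_genus hG hc
  have h2 := G.nIJ_univ_sq root e J
  rw [G.admissible_iff hG, ← numFaces_eq_one_iff] at hJ
  rw [(hG.deleteLines J).det_reducedB, (G.deleteLines J).det_reducedBOriented root hJ] at h2
  rw [← h1]
  have h3 : ((G.nIJ root e Finset.univ J ^ 2 : ℤ) : ℝ) = (2 : ℝ) ^ (2 * (G.deleteLines J).genus) := by
    rw [h2]
    push_cast
    rfl
  push_cast at h3
  rw [h3, ← zpow_natCast]
  push_cast
  rfl

theorem isDualTree_iff {G : FeynmanGraph V Λ} [Nonempty V] (hG : G.Orientable) (J : Finset Λ) :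
    (G.Admissible J ∧ G.kJ J = 0) ↔ G.ribbon.IsDualTree J := by
  constructor
  · rintro ⟨⟨⟨S, hS, hT⟩, -⟩, hk⟩
    have h1 := G.isDualTree_card hT
    rw [kJ] at hk
    have h2 : J = S := (Finset.eq_of_subset_of_card_le hS (by omega)).symm
    rw [h2]
    exact hT
  · intro h
    rw [G.admissible_iff hG, ← numFaces_eq_one_iff]
    have h1 := G.isDualTree_card h
    refine ⟨G.numFaces_deleteLines_of_isDualTree h, ?_⟩
    rw [kJ]
    omega

end FeynmanGraph

namespace FeynmanGraph

variable {V Λ : Type*} (G : FeynmanGraph V Λ) [DecidableEq V] [DecidableEq Λ] [Fintype V]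
  [Fintype Λ] (root : V)

/-! ### The first hyperbolic polynomial -/

open Classical in
theorem prod_kept (I J : Finset Λ) (s : ℝ) :
    ∏ x : {x : Index V Λ root // Kept root I J x},
      (Sum.elim (fun _ => s) (fun _ => s⁻¹) x.1 : ℝ) =
    s ^ Iᶜ.card * s ^ Jᶜ.card * s⁻¹ ^ Fintype.card {v // v ≠ root} := by
  have h : ∀ f : Index V Λ root → ℝ, ∏ x : {x : Index V Λ root // Kept root I J x}, f x.1 =
      ∏ x, if Kept root I J x then f x else 1 := by
    intro f
    rw [← Finset.prod_filter]
    exact (Finset.prod_subtype _ (by simp) f).symm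
  have hc : ∀ S : Finset Λ, ∏ l, (if l ∉ S then s else 1) = s ^ Sᶜ.card := by
    intro S
    rw [← Finset.prod_filter, Finset.prod_const]
    congr 2
    ext l
    simp
  rw [h, Fintype.prod_sum_type, Fintype.prod_sum_type, ← hc, ← hc]
  refine congrArg₂ (· * ·) (congrArg₂ (· * ·) ?_ ?_) ?_
  · exact Finset.prod_congr rfl fun l _ => if_congr Iff.rfl rfl rfl
  · exact Finset.prod_congr rfl fun l _ => if_congr Iff.rfl rfl rfl
  · exact (Finset.prod_congr rfl fun v _ => if_pos trivial).trans (by simp)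

-- Multiplying the rows of the line variables by `s` and the columns of the hypermomenta by `s⁻¹`
-- turns `B'` into `B`: the factors combine to `s` on `E` and cancel on `C`.
open Classical in
theorem det_B_submatrix (e : Ordering V Λ root) (I J : Finset Λ) {s : ℝ} (hs : s ≠ 0) :
    ((G.B root s).submatrix (Subtype.val : {x // Kept root I J x} → _)
      (Subtype.val : {x // Kept root I J x} → _)).det =
    s ^ Iᶜ.card * s ^ Jᶜ.card * s⁻¹ ^ Fintype.card {v // v ≠ root} *
      (G.nIJ root e I J : ℝ) ^ 2 := by
  have h1 : (G.B root s).submatrix (Subtype.val : {x // Kept root I J x} → _)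
      (Subtype.val : {x // Kept root I J x} → _) =
      Matrix.diagonal (fun x : {x // Kept root I J x} =>
        (Sum.elim (fun _ => s) (fun _ => 1) x.1 : ℝ)) *
      ((G.Bprime root).submatrix (Subtype.val : {x // Kept root I J x} → _)
        (Subtype.val : {x // Kept root I J x} → _)).map (Int.cast : ℤ → ℝ) *
      Matrix.diagonal (fun x : {x // Kept root I J x} =>
        (Sum.elim (fun _ => 1) (fun _ => s⁻¹) x.1 : ℝ)) := by
    ext ⟨x, hx⟩ ⟨y, hy⟩
    rw [Matrix.mul_diagonal, Matrix.diagonal_mul]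
    rcases x with x | v <;> rcases y with y | v' <;>
      simp [B, Bprime, mul_comm s, hs]
  have h2 : (((G.Bprime root).submatrix (Subtype.val : {x // Kept root I J x} → _)
        (Subtype.val : {x // Kept root I J x} → _)).map (Int.cast : ℤ → ℝ)).det =
      (G.nIJ root e I J : ℝ) ^ 2 := by
    rw [← Int.cast_pow, nIJ_sq]
    exact ((Int.castRingHom ℝ).map_det _).symm
  rw [h1, Matrix.det_mul, Matrix.det_mul, h2, Matrix.det_diagonal, Matrix.det_diagonal,
    ← prod_kept root I J s, mul_right_comm, ← Finset.prod_mul_distrib]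
  congr 1
  refine Finset.prod_congr rfl fun x _ => ?_
  rcases x with ⟨x | v, hx⟩ <;> simp

theorem HU_eq_sum {G : FeynmanGraph V Λ} (hc : G.Connected) (e : Ordering V Λ root) {s : ℝ}
    (hs : s ≠ 0) (t : Λ → ℝ) (ht : ∀ l, t l ≠ 0) :
    G.HU root s t = ∑ I : Finset Λ, ∑ J : Finset Λ,
      s ^ (2 * (G.genus : ℤ) - G.kIJ I J) * (G.nIJ root e I J : ℝ) ^ 2 *
        (∏ l ∈ Iᶜ, t l) * ∏ l ∈ J, t l := by
  classical
  have : Nonempty V := ⟨root⟩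
  rw [HU, A, det_diagonal_add, ← (Finset.sumEquiv (α := Λ ⊕ Λ)
    (β := {v // v ≠ root})).symm.toEquiv.sum_comp, Fintype.sum_prod_type]
  -- The diagonal part is 0 on the hypermomenta, so only sets of line variables contribute.
  have h1 : ∀ P : Finset (Λ ⊕ Λ), ∀ Q : Finset {v // v ≠ root}, Q ≠ ∅ →
      ∏ i ∈ P.disjSum Q, (Sum.elim (Sum.elim (fun l => 1 / t l) t) (fun _ => 0) i : ℝ) = 0 := by
    intro P Q hQ
    obtain ⟨v, hv⟩ := Finset.nonempty_iff_ne_empty.2 hQ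
    exact Finset.prod_eq_zero (i := Sum.inr v) (by simpa using hv) rfl
  have h2 : ∀ P : Finset (Λ ⊕ Λ), ∀ f : Finset ((Λ ⊕ Λ) ⊕ {v // v ≠ root}) → ℝ,
      ∑ Q : Finset {v // v ≠ root}, (∏ i ∈ P.disjSum Q,
        (Sum.elim (Sum.elim (fun l => 1 / t l) t) (fun _ => 0) i : ℝ)) * f (P.disjSum Q) =
      (∏ i ∈ P, (Sum.elim (fun l => 1 / t l) t i : ℝ)) * f (P.disjSum ∅) := by
    intro P f
    rw [Finset.sum_eq_single ∅ (fun Q _ hQ => by rw [h1 P Q hQ, zero_mul]) (by simp)]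
    congr 1
    rw [Finset.prod_disjSum]
    simp
  have h3 := fun P => h2 P fun S => ((G.B root s).submatrix
    (Subtype.val : {i // i ∉ S} → _) (Subtype.val : {i // i ∉ S} → _)).det
  refine (congrArg _ (Finset.sum_congr rfl fun P _ => h3 P)).trans ?_
  rw [← (Finset.sumEquiv (α := Λ) (β := Λ)).symm.toEquiv.sum_comp, Fintype.sum_prod_type,
    Finset.mul_sum]
  refine Finset.sum_congr rfl fun I _ => ?_
  rw [Finset.mul_sum]
  refine Finset.sum_congr rfl fun J _ => ?_
  have h4 : ((G.B root s).submatrix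
      (Subtype.val : {i // i ∉ (I.disjSum J).disjSum (∅ : Finset {v // v ≠ root})} → _)
      (Subtype.val : {i // i ∉ (I.disjSum J).disjSum (∅ : Finset {v // v ≠ root})} → _)).det =
      ((G.B root s).submatrix (Subtype.val : {x // Kept root I J x} → _)
      (Subtype.val : {x // Kept root I J x} → _)).det := by
    rw [← Matrix.det_submatrix_equiv_self (Equiv.subtypeEquivRight
      (p := fun i => i ∉ (I.disjSum J).disjSum (∅ : Finset {v // v ≠ root}))
      (q := Kept root I J) (by rintro ((l | l) | v) <;> simp [Kept]))]
    rfl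
  have h5 : (∏ l, t l) * ∏ l ∈ I, 1 / t l = ∏ l ∈ Iᶜ, t l := by
    rw [← Finset.prod_mul_prod_compl I t, mul_right_comm, ← Finset.prod_mul_distrib,
      Finset.prod_eq_one fun l _ => mul_one_div_cancel (ht l), one_mul]
  -- The exponent is `2L - |I| - |J| - (n - 1)`, which Euler's relation rewrites.
  have h6 : s ^ Iᶜ.card * s ^ Jᶜ.card * s⁻¹ ^ Fintype.card {v // v ≠ root} =
      s ^ (2 * (G.genus : ℤ) - G.kIJ I J) := by
    rw [inv_pow, ← zpow_natCast, ← zpow_natCast, ← zpow_natCast, ← zpow_neg, ← zpow_add₀ hs,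
      ← zpow_add₀ hs]
    congr 1
    have h7 := hc.two_mul_genus
    have h8 := card_ne_root root
    rw [Finset.card_compl, Finset.card_compl, Nat.cast_sub I.card_le_univ,
      Nat.cast_sub J.card_le_univ, kIJ]
    omega
  change (∏ l, t l) * ((∏ i ∈ I.disjSum J, (Sum.elim (fun l => 1 / t l) t i : ℝ)) *
    ((G.B root s).submatrix
      (Subtype.val : {i // i ∉ (I.disjSum J).disjSum (∅ : Finset {v // v ≠ root})} → _)
      (Subtype.val : {i // i ∉ (I.disjSum J).disjSum (∅ : Finset {v // v ≠ root})} → _)).det) = _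
  rw [h4, G.det_B_submatrix root e I J hs, h6, Finset.prod_disjSum, ← h5]
  simp only [Sum.elim_inl, Sum.elim_inr]
  ring

/-- An ordering of the surviving indices. -/
def defaultOrdering : Ordering V Λ root := fun I J =>
  (Finite.equivFin {x : Index V Λ root // Kept root I J x}).symm

theorem kIJ_univ (J : Finset Λ) : G.kIJ Finset.univ J = G.kJ J := by
  rw [kIJ, kJ, Finset.card_univ]
  ring

-- Every term of the expansion is nonnegative, so it suffices to keep `I` full and `J` admissible;
-- there `n_{I,J}^2 = 2^(2g - k_J)` merges with the power of `s`.
open Classical in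
theorem sum_admissible_le_HU {G : FeynmanGraph V Λ} (hG : G.Orientable) (hc : G.Connected) {s : ℝ}
    (hs : 0 < s) (t : Λ → ℝ) (ht : ∀ l, 0 < t l) :
    (∑ J : Finset Λ with G.Admissible J,
      (2 * s) ^ (2 * (G.genus : ℤ) - G.kJ J) * ∏ l ∈ J, t l) ≤ G.HU root s t := by
  let e := defaultOrdering (Λ := Λ) root
  have hpos : ∀ S : Finset Λ, 0 ≤ ∏ l ∈ S, t l := fun S => Finset.prod_nonneg fun l _ => (ht l).le
  have hterm : ∀ I J : Finset Λ, 0 ≤ s ^ (2 * (G.genus : ℤ) - G.kIJ I J) *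
      (G.nIJ root e I J : ℝ) ^ 2 * (∏ l ∈ Iᶜ, t l) * ∏ l ∈ J, t l := fun I J =>
    mul_nonneg (mul_nonneg (mul_nonneg (zpow_nonneg hs.le _) (sq_nonneg _)) (hpos _)) (hpos _)
  rw [HU_eq_sum root hc e hs.ne' t fun l => (ht l).ne']
  refine le_trans ?_ (Finset.single_le_sum (fun I _ => Finset.sum_nonneg fun J _ => hterm I J)
    (Finset.mem_univ Finset.univ))
  refine le_trans (le_of_eq ?_) (Finset.sum_le_sum_of_subset_of_nonneg
    (Finset.filter_subset G.Admissible Finset.univ) fun J _ _ => hterm _ J)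
  refine Finset.sum_congr rfl fun J hJ => ?_
  rw [(Finset.mem_filter.1 hJ).2.nIJ_univ_sq root hG hc e, kIJ_univ, Finset.compl_univ,
    Finset.prod_empty, mul_zpow]
  ring

open Classical in
theorem sum_dualTree_le_HU {G : FeynmanGraph V Λ} (hG : G.Orientable) (hc : G.Connected) {s : ℝ}
    (hs : 0 < s) (t : Λ → ℝ) (ht : ∀ l, 0 < t l) :
    (2 * s) ^ (2 * G.genus) *
      (∑ T : Finset Λ with G.ribbon.IsDualTree T, ∏ l ∈ T, t l) ≤ G.HU root s t := by
  have : Nonempty V := ⟨root⟩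
  refine le_trans ?_ (sum_admissible_le_HU root hG hc hs t ht)
  rw [Finset.mul_sum]
  have hsub : Finset.univ.filter G.ribbon.IsDualTree ⊆
      Finset.univ.filter G.Admissible := fun T hT => by
    rw [Finset.mem_filter] at hT ⊢
    exact ⟨hT.1, ((isDualTree_iff hG T).2 hT.2).1⟩
  refine le_trans (le_of_eq ?_) (Finset.sum_le_sum_of_subset_of_nonneg hsub fun J _ _ =>
    mul_nonneg (zpow_nonneg (by positivity) _) (Finset.prod_nonneg fun l _ => (ht l).le))
  refine Finset.sum_congr rfl fun T hT => ?_
  rw [((isDualTree_iff hG T).2 (Finset.mem_filter.1 hT).2).2, sub_zero, ← zpow_natCast]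
  push_cast
  rfl

/-! ### Scaling -/

/-- A single tree of the dual graph, which has `F - 1` lines, gives the lower bound. For the upper
bound, the coefficients of degree below `F - 1` vanish and, as `r ≤ 1`, the higher powers are
dominated. -/
theorem HU_scaling {G : FeynmanGraph V Λ} (hG : G.Orientable) (hc : G.Connected) {s : ℝ}
    (hs : 0 < s) (x : Λ → ℝ) (hx : ∀ l, 0 < x l) :
    ∃ a b : ℝ, 0 < a ∧ ∀ r : ℝ, 0 < r → r ≤ 1 →
      a * r ^ (G.numFaces - 1) ≤ G.HU root s (fun l => r * x l) ∧
      G.HU root s (fun l => r * x l) ≤ b * r ^ (G.numFaces - 1) := by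
  classical
  have : Nonempty V := ⟨root⟩
  let e := defaultOrdering (Λ := Λ) root
  have hpos : ∀ S : Finset Λ, 0 ≤ ∏ l ∈ S, x l := fun S => Finset.prod_nonneg fun l _ => (hx l).le
  let c : Finset Λ → Finset Λ → ℝ := fun I J => s ^ (2 * (G.genus : ℤ) - G.kIJ I J) *
      (G.nIJ root e I J : ℝ) ^ 2 * (∏ l ∈ Iᶜ, x l) * ∏ l ∈ J, x l
  have hc0 : ∀ I J, 0 ≤ c I J := fun I J =>
    mul_nonneg (mul_nonneg (mul_nonneg (zpow_nonneg hs.le _) (sq_nonneg _)) (hpos _)) (hpos _)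
  obtain ⟨T, hT⟩ := hc.exists_isDualTree
  refine ⟨(2 * s) ^ (2 * G.genus) * ∏ l ∈ T, x l, ∑ I, ∑ J, c I J,
    mul_pos (by positivity) (Finset.prod_pos fun l _ => hx l), fun r hr hr1 => ⟨?_, ?_⟩⟩
  · refine le_trans ?_ (sum_dualTree_le_HU root hG hc hs (fun l => r * x l)
      fun l => mul_pos hr (hx l))
    rw [mul_assoc]
    refine mul_le_mul_of_nonneg_left ?_ (by positivity)
    refine le_trans (le_of_eq ?_) (Finset.single_le_sum (fun S _ => Finset.prod_nonneg
      fun l _ => (mul_pos hr (hx l)).le) (Finset.mem_filter.2 ⟨Finset.mem_univ T, hT⟩))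
    have h1 := G.isDualTree_card hT
    rw [Finset.prod_mul_distrib, Finset.prod_const, mul_comm, ← h1, Nat.add_sub_cancel]
  · rw [HU_eq_sum root hc e hs.ne' _ fun l => (mul_pos hr (hx l)).ne', Finset.sum_mul]
    refine Finset.sum_le_sum fun I _ => ?_
    rw [Finset.sum_mul]
    refine Finset.sum_le_sum fun J _ => ?_
    by_cases h : Iᶜ.card + J.card + 1 < G.numFaces
    · simp only [c, hG.nIJ_eq_zero root e I J h]
      simp
    · have h1 : r ^ (Iᶜ.card + J.card) ≤ r ^ (G.numFaces - 1) :=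
        pow_le_pow_of_le_one hr.le hr1 (by omega)
      refine le_trans (le_of_eq ?_) (mul_le_mul_of_nonneg_left h1 (hc0 I J))
      simp only [c, Finset.prod_mul_distrib, Finset.prod_const, pow_add]
      ring

theorem HU_isTheta {G : FeynmanGraph V Λ} (hG : G.Orientable) (hc : G.Connected) {s : ℝ}
    (hs : 0 < s) (x : Λ → ℝ) (hx : ∀ l, 0 < x l) :
    (fun r : ℝ => G.HU root s (fun l => r * x l))
      =Θ[𝓝[>] 0] (fun r : ℝ => r ^ ((G.numFaces : ℤ) - 1)) := by
  have : Nonempty V := ⟨root⟩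
  obtain ⟨a, b, ha, h⟩ := HU_scaling root hG hc hs x hx
  have hz : ∀ r : ℝ, r ^ ((G.numFaces : ℤ) - 1) = r ^ (G.numFaces - 1) := by
    intro r
    have := G.numFaces_pos
    rw [← zpow_natCast, Nat.cast_sub (by omega)]
    rfl
  have hev : ∀ᶠ r : ℝ in 𝓝[>] 0, 0 < r ∧ r ≤ 1 := by
    filter_upwards [Ioc_mem_nhdsGT (zero_lt_one (α := ℝ))] with r hr
    exact hr
  constructor
  · refine Asymptotics.IsBigO.of_bound b ?_
    filter_upwards [hev] with r hr
    have h1 := h r hr.1 hr.2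
    have h2 : 0 < r ^ (G.numFaces - 1) := pow_pos hr.1 _
    rw [hz, Real.norm_of_nonneg (le_trans (by positivity) h1.1), Real.norm_of_nonneg h2.le]
    exact h1.2
  · refine Asymptotics.IsBigO.of_bound a⁻¹ ?_
    filter_upwards [hev] with r hr
    have h1 := h r hr.1 hr.2
    have h2 : 0 < r ^ (G.numFaces - 1) := pow_pos hr.1 _
    rw [hz, Real.norm_of_nonneg (le_trans (by positivity) h1.1), Real.norm_of_nonneg h2.le,
      inv_mul_eq_div, le_div_iff₀ ha, mul_comm]
    exact h1.1

theorem numExternal_add : G.numExternal + 2 * Fintype.card Λ = ∑ v, G.deg v := by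
  classical
  have h1 := G.ribbon.sum_corners
    (fun c => if ∀ l, G.tail l ≠ c ∧ G.head l ≠ c then 0 else 1) (fun c hc => if_pos hc)
  have h2 : ∀ l, ¬ ∀ l', G.tail l' ≠ G.tail l ∧ G.head l' ≠ G.tail l := fun l h => (h l).1 rfl
  have h3 : ∀ l, ¬ ∀ l', G.tail l' ≠ G.head l ∧ G.head l' ≠ G.head l := fun l h => (h l).2 rfl
  have h4 : ∑ c : G.Corner, (if ∀ l, G.tail l ≠ c ∧ G.head l ≠ c then 0 else 1) =
      2 * Fintype.card Λ := by
    refine h1.trans ((Finset.sum_congr rfl fun l _ =>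
      congrArg₂ (· + ·) (if_neg (h2 l)) (if_neg (h3 l))).trans ?_)
    simp [mul_comm]
  have h5 : G.numExternal = ∑ c : G.Corner, if ∀ l, G.tail l ≠ c ∧ G.head l ≠ c then 1 else 0 := by
    rw [numExternal, Nat.card_eq_fintype_card, Fintype.card_subtype, Finset.card_filter]
  rw [h5, ← h4, ← Finset.sum_add_distrib]
  have h6 : Fintype.card G.Corner = ∑ v, G.deg v := by
    rw [Fintype.card_sigma]
    simp
  rw [← h6, Fintype.card_eq_sum_ones]
  exact Finset.sum_congr rfl fun c _ => by split_ifs <;> rfl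

theorem amplitudeDensity_isTheta {G : FeynmanGraph V Λ} (hG : G.Orientable) (hc : G.Connected)
    {s : ℝ} (hs : 0 < s) (x : Λ → ℝ) (hx : ∀ l, 0 < x l) (hdeg : ∀ v, G.deg v = 4) :
    (fun r : ℝ => r ^ (2 * (Fintype.card Λ : ℤ) - 1) *
        G.amplitudeDensity root s (fun l => r ^ 2 * x l))
      =Θ[𝓝[>] 0]
        (fun r : ℝ => r ^ (8 * (G.genus : ℤ) + G.numExternal - 5)) := by
  have : Nonempty V := ⟨root⟩
  have hsq : Filter.Tendsto (fun r : ℝ => r ^ 2) (𝓝[>] 0) (𝓝[>] 0) := by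
    refine tendsto_nhdsWithin_iff.2 ⟨?_, ?_⟩
    · have : Filter.Tendsto (fun r : ℝ => r ^ 2) (𝓝 0) (𝓝 (0 ^ 2)) :=
        (continuous_pow 2).tendsto 0
      rw [zero_pow two_ne_zero] at this
      exact this.mono_left nhdsWithin_le_nhds
    · filter_upwards [self_mem_nhdsWithin] with r hr
      exact pow_pos (Set.mem_Ioi.1 hr) 2
  have h1 : (fun r : ℝ => G.HU root s (fun l => r ^ 2 * x l))
      =Θ[𝓝[>] 0] (fun r : ℝ => (r ^ 2) ^ ((G.numFaces : ℤ) - 1)) := by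
    have := HU_isTheta root hG hc hs x hx
    exact ⟨this.1.comp_tendsto hsq, this.2.comp_tendsto hsq⟩
  have h2 : (fun r : ℝ => ∏ l, (1 - (r ^ 2 * x l) ^ 2)) =Θ[𝓝[>] 0] (fun _ : ℝ => (1 : ℝ)) := by
    have hcont : Continuous fun r : ℝ => ∏ l, (1 - (r ^ 2 * x l) ^ 2) := by fun_prop
    have ht : Filter.Tendsto (fun r : ℝ => ∏ l, (1 - (r ^ 2 * x l) ^ 2)) (𝓝[>] 0) (𝓝 1) := by
      have := hcont.tendsto 0
      simp only [zero_pow two_ne_zero, zero_mul, sub_zero, Finset.prod_const_one] at this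
      exact this.mono_left nhdsWithin_le_nhds
    exact (Asymptotics.isTheta_of_div_tendsto_nhds_ne_zero (c := 1) (by simpa using ht)
      one_ne_zero).symm
  have h3 := (Asymptotics.isTheta_refl (fun r : ℝ => r ^ (2 * (Fintype.card Λ : ℤ) - 1))
    (𝓝[>] 0)).mul (h2.div (h1.pow 2))
  refine h3.trans_eventuallyEq ?_
  filter_upwards [self_mem_nhdsWithin] with r hr
  have hr0 : r ≠ 0 := ne_of_gt hr
  rw [one_div, ← zpow_natCast r 2, ← zpow_mul, ← zpow_natCast, ← zpow_mul, ← zpow_neg,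
    ← zpow_add₀ hr0]
  -- The exponent is `2L - 1 - 4(F - 1)`; counting corners gives `N + 2L = 4n`, and Euler's relation
  -- eliminates `F`.
  congr 1
  have h4 := G.numExternal_add
  have h5 := hc.two_mul_genus
  simp only [hdeg, Finset.sum_const, Finset.card_univ, smul_eq_mul] at h4
  push_cast
  omega

end FeynmanGraph

end NCQFT

end

/-! ### The main theorem -/

open NCQFT NCQFT.FeynmanGraph Classical in
theorem mainTheorem7 {V Λ : Type*} [Fintype V] [DecidableEq V] [Fintype Λ] [DecidableEq Λ]
    (G : FeynmanGraph V Λ) (hG : G.Orientable) (root : V) :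
    -- the determinants
    ((1 < G.numFaces → (G.reducedB root).det = 0 ∧ (G.reducedBOriented root).det = 0) ∧
     (G.numFaces = 1 → (G.reducedB root).det = 2 ^ (2 * G.genus) ∧
        (G.reducedBOriented root).det = 2 ^ (2 * G.genus))) ∧
    (G.Connected →
      -- the genus satisfies Euler's relation
      (2 - 2 * (G.genus : ℤ) = Fintype.card V - Fintype.card Λ + G.numFaces) ∧
      -- the integers attached to maximal `I`
      (∀ (e : Ordering V Λ root) (J : Finset Λ),
        (G.nIJ root e Finset.univ J ≠ 0 ↔ G.Admissible J) ∧
        (G.Admissible J →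
          (G.nIJ root e Finset.univ J : ℝ) ^ 2 = 2 ^ (2 * (G.genus : ℤ) - G.kJ J))) ∧
      -- the range of `k_J`, and the minimal admissible sets
      (∀ J : Finset Λ, G.Admissible J →
        0 ≤ G.kJ J ∧ G.kJ J ≤ 2 * G.genus ∧ Even (G.kJ J)) ∧
      (∀ J : Finset Λ, (G.Admissible J ∧ G.kJ J = 0) ↔ G.ribbon.IsDualTree J) ∧
      (∀ s : ℝ, 0 < s →
        -- `n_{I,J} ^ 2` are the coefficients of the first hyperbolic polynomial
        (∀ (e : Ordering V Λ root) (t : Λ → ℝ), (∀ l, t l ≠ 0) →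
          G.HU root s t = ∑ I : Finset Λ, ∑ J : Finset Λ,
            s ^ (2 * (G.genus : ℤ) - G.kIJ I J) * (G.nIJ root e I J : ℝ) ^ 2 *
              (∏ l ∈ Iᶜ, t l) * ∏ l ∈ J, t l) ∧
        -- the lower bounds
        (∀ t : Λ → ℝ, (∀ l, 0 < t l) →
          (∑ J : Finset Λ with G.Admissible J,
            (2 * s) ^ (2 * (G.genus : ℤ) - G.kJ J) * ∏ l ∈ J, t l) ≤ G.HU root s t ∧
          (2 * s) ^ (2 * G.genus) *
            (∑ T : Finset Λ with G.ribbon.IsDualTree T, ∏ l ∈ T, t l) ≤ G.HU root s t) ∧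
        -- the exact scaling of `HU` and the exact power counting in four dimensions
        (∀ x : Λ → ℝ, (∀ l, 0 < x l) →
          (fun r : ℝ => G.HU root s (fun l => r * x l))
            =Θ[𝓝[>] 0] (fun r : ℝ => r ^ ((G.numFaces : ℤ) - 1)) ∧
          ((∀ v, G.deg v = 4) →
            (fun r : ℝ => r ^ (2 * (Fintype.card Λ : ℤ) - 1) *
                G.amplitudeDensity root s (fun l => r ^ 2 * x l))
              =Θ[𝓝[>] 0]
                (fun r : ℝ => r ^ (8 * (G.genus : ℤ) + G.numExternal - 5)))))) := by

  have : Nonempty V := ⟨root⟩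
  refine ⟨⟨fun h => ?_, fun h => ?_⟩, fun hc => ⟨?_, ?_, ?_, ?_, ?_⟩⟩
  · rw [hG.det_reducedB root]
    exact ⟨G.det_reducedBOriented_eq_zero root h, G.det_reducedBOriented_eq_zero root h⟩
  · rw [hG.det_reducedB root]
    exact ⟨G.det_reducedBOriented root h, G.det_reducedBOriented root h⟩
  · have := hc.two_mul_genus
    linarith
  · exact fun e J => ⟨hG.nIJ_univ_ne_zero_iff root e J, fun hJ => hJ.nIJ_univ_sq root hG hc e⟩
  · intro J hJ
    -- The dual tree inside `J` gives `k_J ≥ 0`; the graph without `J` has natural genus `g - k_J /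
    -- 2`, which gives the upper bound and the parity.
    have h1 := hJ.numFaces_le
    have h2 := hJ.two_mul_genus hG hc
    refine ⟨?_, by omega, ?_⟩
    · rw [kJ]
      omega
    · rw [Int.even_iff]
      omega
  · exact isDualTree_iff hG
  · intro s hs
    exact ⟨fun e t ht => HU_eq_sum root hc e hs.ne' t ht,
      fun t ht => ⟨sum_admissible_le_HU root hG hc hs t ht, sum_dualTree_le_HU root hG hc hs t ht⟩,
      fun x hx => ⟨HU_isTheta root hG hc hs x hx,
        amplitudeDensity_isTheta root hG hc hs x hx⟩⟩
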